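/- **Setting.** A *logical system* $\mathcal S=(\mathcal L,\mathcal M)$ consists of a set $\mathcal L$ of sentences and a set $\mathcal M$ of interpretations, each of which makes every knowledge-base $L\subseteq\mathcal L$ true or false; $\mathcal M_L$ is the set of models of $L$, and $L\vDash_{\mathcal S}L'$ means $\mathcal M_L\subseteq\mathcal M_{L'}$. For a network $N:X\to X$ on a metric state space, $X_{\inf}$ is the set of all limits $\lim_k N^{t_k}(x_0)$ with $x_0\in X$ and $t_1<t_2<\dots$; $N$ is *stable* if $d(N^t(x),X_{\inf})\to0$ for all $x\in X$. Let $i:X\to2^{\mathcal M}$ depend only on the visible units and let $Agg:2^{2^{\mathcal M}}\to2^{\mathcal M}$; put $\mathcal M_N=Agg(\{i(x):x\in X_{\inf}\})$. Then $N$ is a *semantic encoding* of $L$ under $i$ and $Agg$ if $\emptyset\neq\mathcal M_N\subseteq\mathcal M_L$ and, for every $L'\subseteq\mathcal L$, $L\vDash_{\mathcal S}L'$ iff $\mathcal M_N\subseteq\mathcal M_{L'}$. **Logic.** Let $\Sigma$ be a finite nonempty alphabet. The formulas of first-order logic with majority quantifiers, $\mathrm{FO}(\mathsf M)$, are interpreted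 in nonempty finite strings $w$ over $\Sigma$. Variables range over the positions $1,\dots,|w|$; index terms are built from variables, $1$ and $|w|$ by $+$ and $-$ (integer values); atoms are $a(t)$ ("$t$ is a position carrying the token $a\in\Sigma$"), $s=t$, $s\le t$ and $\mathrm{bit}(s,t)$ ("$s,t\ge 0$ and the coefficient of $2^t$ in the binary expansion of $s$ is $1$"); formulas are closed under $\neg,\wedge,\vee,\exists,\forall$ and $\mathsf M$, where $\mathsf M x\,\varphi$ holds iff $\varphi$ is true for more than half of the positions $x$. The associated classifier system has as sentences the $\alpha\leftrightarrow\varphi$, with $\varphi$ a sentence of $\mathrm{FO}(\mathsf M)$ and $\alpha$ a new nullary predicate, and as interpretations the pairs $(w,\hat\alpha)$ of a nonempty string and a truth value $\hat\alpha\in\{0,1\}$ for $\alpha$; a set of such sentences is true in $(w,\hat\alpha)$ iff all its members are. **Transformers.** For $p\in\mathbb N$ let $\mathbb F_p=\{m2^e: m,e\in\mathbb Z,\ |m|<2^p,\ |e|\le p\}$, and let $\mathrm{rnd}_p$ be rounding towards zero to $\mathbb F_p$ (overflow saturates). A (logarithmic-precision) transformer over $\Sigma$ has a dimension $d$, a number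 of blocks, a precision constant $c\in\mathbb N$, and rational weights, all independent of the input length; on inputs of length $n$ it computes with precision $p=c(\lfloor\log_2 n\rfloor+1)$: the result of every arithmetic operation ($+,-,\cdot,/,\sqrt{\ }$), and every exactly formed sum over coordinates or positions, is rounded by $\mathrm{rnd}_p$. (Division by zero and roots of negative numbers yield $0$.) It consists of (i) an embedding of a token at position $j$ as the sum of a token vector and a position vector; (ii) blocks, each consisting of multi-head attention (affine query, key and value maps, scores $\langle q_j,k_l\rangle/\sqrt{e}$ with $e$ the head dimension, each head with or without a causal mask, weights $\omega(s_{jl}-\max_{l'}s_{jl'})$ normalized by their sum over the attended positions, and an affine combination of the heads) and a feed-forward subnet with one hidden layer and activation function $\sigma$, both with residual connections and optional layer normalizations before the sublayer and after the residual connection; (iii) an optional final layer normalization and an affine classifier, applied to the vector at the last position, whose output label is $1$ iff its value is positive. The weight function $\omega$ (an implementation of $\exp$ in the case of softmax), the activation $\sigma$ and each position coordinate are arbitrary functions that are uniformly computable in the following sense: measured in units of $2^{-p}$, and before rounding, their values are differences of two lower elementary functions of $2^p$ and the positive and negative parts of the argument (for position coordinates, of $2^p$, $n$ and the position). The *lower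 elementary* functions $\mathbb N^k\to\mathbb N$ are the least class that contains constants, projections, sums and truncated differences and is closed under composition and bounded summation $\sum_{y\le x}$. The transformer is regarded as a network whose states consist of an input string $w$ of arbitrary length $n\ge1$, an output label in $\{0,1\}$, and real hidden activations for all layers and positions. Tokens and labels carry the discrete metric and activations the supremum metric, and states for inputs of different lengths are at distance at least $1$. One update keeps $w$ and recomputes each layer from the current values of the preceding one and the label from the current values of the last layer. The input and output neurons are visible, all others are hidden, and the computation time is $1$. The encoding function is $i(x)=\{(w,\hat\alpha)\}$, where $w$ is the input string and $\hat\alpha$ the output label in the state $x$. **Proposition.** Let $T$ be a transformer over a finite nonempty alphabet $\Sigma$. Then $T$ is stable, and there is a single sentence $\varphi$ of $\mathrm{FO}(\mathsf M)$, valid for all input lengths, such that $T$ is a semantic encoding of the knowledge-base $\{\alpha\leftrightarrow\varphi\}$ under $i$ and $Agg=\bigcup$. -/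

import Mathlib

open Set Filter Topology

universe u

/-! ## Logical systems, candidate networks and semantic encodings -/

/-- A logical system: a language together with a family of interpretations, each of which
decides the truth of every knowledge-base (set of sentences). -/
structure LogicalSystem where
  Sentence : Type u
  Interp : Type u
  /-- `truth M L` means that `L` is true in `M`, i.e. that `M` is a model of `L`. -/
  truth : Interp → Set Sentence → Prop

namespace LogicalSystem

/-- The set of models of a knowledge-base. -/
def models (S : LogicalSystem.{u}) (L : Set S.Sentence) : Set S.Interp :=
  {M | S.truth M L}

/-- Semantic entailment between knowledge-bases. -/
def Entails (S : LogicalSystem.{u}) (L L' : Set S.Sentence) : Prop :=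
  ∀ M : S.Interp, S.truth M L → S.truth M L'

/-- The sentence `α ↔ φ`, where `α` is a new nullary predicate and `φ` a sentence of `𝓛`. -/
structure AlphaIff (𝓛 : Type u) where
  body : 𝓛

/-- The system of logical classifiers over `S`: its sentences are the `α ↔ φ`, its
interpretations are the pairs of an interpretation of `S` and a truth value of `α`, and a
knowledge-base is true in an interpretation iff each of its members is. -/
def classifierSystem (S : LogicalSystem.{u}) : LogicalSystem.{u} where
  Sentence := AlphaIff S.Sentence
  Interp := S.Interp × Bool
  truth M K := ∀ ψ ∈ K, (M.2 = true ↔ S.truth M.1 {ψ.body})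

end LogicalSystem

/-- A candidate network: a metric state space, an update map, a projection of states to the
configuration of their visible units, and a positive computation time. -/
structure CandidateNetwork where
  State : Type u
  metric : MetricSpace State
  Visible : Type u
  vis : State → Visible
  step : State → State
  tc : ℕ
  tc_pos : 0 < tc

namespace CandidateNetwork

instance (N : CandidateNetwork.{u}) : MetricSpace N.State := N.metric

/-- One semantic update: the update map applied `tc` times. -/
def update (N : CandidateNetwork.{u}) : N.State → N.State := N.step^[N.tc]

/-- Two states are equivalent iff their visible configurations agree. -/
def Equivalent (N : CandidateNetwork.{u}) (x y : N.State) : Prop := N.vis x = N.vis y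

/-- The set of limit points of the dynamics. -/
def Xinf (N : CandidateNetwork.{u}) : Set N.State :=
  {x | ∃ (x₀ : N.State) (t : ℕ → ℕ), StrictMono t ∧
    Tendsto (fun k => N.update^[t k] x₀) atTop (𝓝 x)}

/-- A network is stable if every trajectory converges to the set of limit points. -/
def IsStable (N : CandidateNetwork.{u}) : Prop :=
  ∀ x : N.State, Tendsto (fun t : ℕ => Metric.infDist (N.update^[t] x) N.Xinf) atTop (𝓝 0)

/-- An encoding function: it sends a state to a set of interpretations, and equivalent states
to the same set. -/
structure EncodingFunction (N : CandidateNetwork.{u}) (S : LogicalSystem.{u}) where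
  toFun : N.State → Set S.Interp
  respects : ∀ x y, N.Equivalent x y → toFun x = toFun y

variable {N : CandidateNetwork.{u}} {S : LogicalSystem.{u}}

/-- The set of interpretations represented by the network. -/
def represented (i : EncodingFunction N S) (Agg : Set (Set S.Interp) → Set S.Interp) :
    Set S.Interp :=
  Agg (i.toFun '' N.Xinf)

/-- `N` is a neural model of the knowledge-base `L` under `i` and `Agg`. -/
def IsNeuralModel (i : EncodingFunction N S) (Agg : Set (Set S.Interp) → Set S.Interp)
    (L : Set S.Sentence) : Prop :=
  (represented i Agg).Nonempty ∧ represented i Agg ⊆ S.models L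

/-- `N` is a semantic encoding of the knowledge-base `L` under `i` and `Agg`. -/
def IsSemanticEncoding (i : EncodingFunction N S) (Agg : Set (Set S.Interp) → Set S.Interp)
    (L : Set S.Sentence) : Prop :=
  IsNeuralModel i Agg L ∧
    ∀ L' : Set S.Sentence, S.Entails L L' ↔ represented i Agg ⊆ S.models L'

end CandidateNetwork

/-! ## First-order logic with majority quantifiers over strings -/

/-- Nonempty strings; the string `⟨n, w⟩` has length `n + 1`. -/
abbrev Str (α : Type u) : Type u := Σ n : ℕ, (Fin (n + 1) → α)

namespace FOM

/-- Index terms in the variables `x₀, …, x_{k-1}`. -/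
inductive Term (k : ℕ) : Type
  | var (i : Fin k) : Term k
  | one : Term k
  | len : Term k
  | add (s t : Term k) : Term k
  | sub (s t : Term k) : Term k

/-- The value of an index term in a string of length `n`, the variables being interpreted by
positions `1, …, n`. -/
def Term.eval {k : ℕ} (n : ℕ) (v : Fin k → ℕ) : Term k → ℤ
  | .var i => (v i : ℤ)
  | .one => 1
  | .len => (n : ℤ)
  | .add s t => s.eval n v + t.eval n v
  | .sub s t => s.eval n v - t.eval n v

/-- Formulas of first-order logic with majority quantifiers over the alphabet `α`, with free
variables among `x₀, …, x_{k-1}`; a quantifier binds `x_k`. -/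
inductive Formula (α : Type u) : ℕ → Type u
  | token {k : ℕ} (a : α) (t : Term k) : Formula α k
  | eq {k : ℕ} (s t : Term k) : Formula α k
  | le {k : ℕ} (s t : Term k) : Formula α k
  | bit {k : ℕ} (s t : Term k) : Formula α k
  | not {k : ℕ} (φ : Formula α k) : Formula α k
  | and {k : ℕ} (φ ψ : Formula α k) : Formula α k
  | or {k : ℕ} (φ ψ : Formula α k) : Formula α k
  | ex {k : ℕ} (φ : Formula α (k + 1)) : Formula α k
  | all {k : ℕ} (φ : Formula α (k + 1)) : Formula α k
  | maj {k : ℕ} (φ : Formula α (k + 1)) : Formula α k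

/-- A sentence is a formula without free variables. -/
abbrev Sentence (α : Type u) : Type u := Formula α 0

open Classical in
/-- Satisfaction in the string `w`. Quantifiers range over the positions `1, …, |w|`, and
`maj φ` holds iff `φ` is true for more than half of them; `token a t` says that `t` denotes a
position carrying the token `a`; `bit s t` says that the values `x` of `s` and `j` of `t` are
nonnegative and that the coefficient of `2 ^ j` in the binary expansion of `x` is `1`. -/
def Formula.Sat {α : Type u} (w : Str α) : {k : ℕ} → Formula α k → (Fin k → ℕ) → Prop
  | _, .token a t, v => ∃ p : Fin (w.1 + 1), t.eval (w.1 + 1) v = (p : ℤ) + 1 ∧ w.2 p = a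
  | _, .eq s t, v => s.eval (w.1 + 1) v = t.eval (w.1 + 1) v
  | _, .le s t, v => s.eval (w.1 + 1) v ≤ t.eval (w.1 + 1) v
  | _, .bit s t, v => 0 ≤ s.eval (w.1 + 1) v ∧ 0 ≤ t.eval (w.1 + 1) v ∧
      (s.eval (w.1 + 1) v).toNat.testBit (t.eval (w.1 + 1) v).toNat = true
  | _, .not φ, v => ¬ φ.Sat w v
  | _, .and φ ψ, v => φ.Sat w v ∧ ψ.Sat w v
  | _, .or φ ψ, v => φ.Sat w v ∨ ψ.Sat w v
  | _, .ex φ, v => ∃ x ∈ Finset.Icc 1 (w.1 + 1), φ.Sat w (Fin.snoc (α := fun _ => ℕ) v x)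
  | _, .all φ, v => ∀ x ∈ Finset.Icc 1 (w.1 + 1), φ.Sat w (Fin.snoc (α := fun _ => ℕ) v x)
  | _, .maj φ, v => w.1 + 1 <
      2 * ((Finset.Icc 1 (w.1 + 1)).filter
        (fun x => φ.Sat w (Fin.snoc (α := fun _ => ℕ) v x))).card

/-- The logical system of first-order logic with majority quantifiers: interpretations are
strings, and a knowledge-base is true in a string iff all its members are. -/
def system (α : Type u) : LogicalSystem.{u} where
  Sentence := Sentence α
  Interp := Str α
  truth w L := ∀ φ ∈ L, φ.Sat w Fin.elim0

end FOM

/-! ## Logarithmic-precision arithmetic -/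

/-- The lower elementary functions of natural numbers (in the sense of Skolem): the least class
that contains the constants, projections, sums and truncated differences and is closed under
composition and bounded summation. -/
inductive LowerElementary : {k : ℕ} → ((Fin k → ℕ) → ℕ) → Prop
  | const {k : ℕ} (c : ℕ) : LowerElementary (fun _ : Fin k → ℕ => c)
  | proj {k : ℕ} (i : Fin k) : LowerElementary (fun v : Fin k → ℕ => v i)
  | add {k : ℕ} {f g : (Fin k → ℕ) → ℕ} (hf : LowerElementary f) (hg : LowerElementary g) :
      LowerElementary (fun v => f v + g v)
  | sub {k : ℕ} {f g : (Fin k → ℕ) → ℕ} (hf : LowerElementary f) (hg : LowerElementary g) :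
      LowerElementary (fun v => f v - g v)
  | comp {k l : ℕ} {f : (Fin k → ℕ) → ℕ} {g : Fin k → (Fin l → ℕ) → ℕ}
      (hf : LowerElementary f) (hg : ∀ i, LowerElementary (g i)) :
      LowerElementary (fun v => f (fun i => g i v))
  | bsum {k : ℕ} {f : (Fin (k + 1) → ℕ) → ℕ} (hf : LowerElementary f) :
      LowerElementary (fun v : Fin (k + 1) → ℕ =>
        ∑ y ∈ Finset.range (v (Fin.last k) + 1), f (Fin.snoc (α := fun _ => ℕ) (Fin.init v) y))

/-- An integer-valued function presented as a difference of lower elementary functions. -/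
structure UniformMap (k : ℕ) where
  pos : (Fin k → ℕ) → ℕ
  neg : (Fin k → ℕ) → ℕ
  pos_le : LowerElementary pos
  neg_le : LowerElementary neg

/-- The value of a uniform map. -/
def UniformMap.eval {k : ℕ} (f : UniformMap k) (v : Fin k → ℕ) : ℤ := (f.pos v : ℤ) - f.neg v

/-- The floating-point numbers of precision `p`: `m * 2 ^ e` with a mantissa of `p` bits. -/
def floats (p : ℕ) : Set ℝ :=
  {y | ∃ m e : ℤ, |m| < 2 ^ p ∧ |e| ≤ (p : ℤ) ∧ y = (m : ℝ) * (2 : ℝ) ^ e}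

/-- Rounding towards zero to precision `p`: for `x ≥ 0` the greatest float that is at most `x`
(so that overflow saturates and underflow gives zero), and `rnd p (-x) = -rnd p x`. -/
noncomputable def rnd (p : ℕ) (x : ℝ) : ℝ :=
  if 0 ≤ x then sSup {y | y ∈ floats p ∧ y ≤ x} else -sSup {y | y ∈ floats p ∧ y ≤ -x}

/-- The precision `p`-implementation of a scalar function that is specified by a uniform map in
the arguments `2 ^ p`, `k⁺`, `k⁻`, where `k = ⌊x * 2 ^ p⌋` is the argument in units of `2 ^ (-p)`
(all floats are integer multiples of this unit); the value is also in these units. -/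
noncomputable def UniformMap.scalar (f : UniformMap 3) (p : ℕ) (x : ℝ) : ℝ :=
  rnd p ((f.eval ![2 ^ p, ⌊x * 2 ^ p⌋.toNat, (-⌊x * 2 ^ p⌋).toNat] : ℝ) / 2 ^ p)

/-- The precision `p`-value of a positional feature at position `i` of a string of length `n`,
specified by a uniform map in the arguments `2 ^ p`, `n`, `i`. -/
noncomputable def UniformMap.position (f : UniformMap 3) (p n i : ℕ) : ℝ :=
  rnd p ((f.eval ![2 ^ p, n, i] : ℝ) / 2 ^ p)

/-- Inner product in precision `p`: all products are rounded, their exact sum is rounded once. -/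
noncomputable def fdot (p : ℕ) {ι : Type*} (s : Finset ι) (x y : ι → ℝ) : ℝ :=
  rnd p (∑ j ∈ s, rnd p (x j * y j))

/-! ## Transformers -/

/-- An affine map with rational parameters. -/
structure AffineMapQ (ι κ : Type) where
  weight : κ → ι → ℚ
  bias : κ → ℚ

/-- Application of an affine map in precision `p`. -/
noncomputable def AffineMapQ.apply {ι κ : Type} [Fintype ι] (A : AffineMapQ ι κ) (p : ℕ)
    (x : ι → ℝ) (k : κ) : ℝ :=
  rnd p (fdot p Finset.univ (fun j => rnd p (A.weight k j)) x + rnd p (A.bias k))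

/-- The parameters of a layer normalization. -/
structure LayerNorm (d : ℕ) where
  gain : Fin d → ℚ
  shift : Fin d → ℚ
  eps : ℚ

/-- Layer normalization in precision `p`:
`gain * (x - mean x) / sqrt (variance x + eps) + shift`. -/
noncomputable def LayerNorm.apply {d : ℕ} (N : LayerNorm d) (p : ℕ) (x : Fin d → ℝ) :
    Fin d → ℝ :=
  let mean := rnd p (rnd p (∑ k, x k) / d)
  let y : Fin d → ℝ := fun k => rnd p (x k - mean)
  let var := rnd p (fdot p Finset.univ y y / d)
  let sd := rnd p (√(rnd p (var + rnd p N.eps)))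
  fun k => rnd p (rnd p (rnd p (N.gain k) * rnd p (y k / sd)) + rnd p (N.shift k))

/-- An optional layer normalization (the identity if absent). -/
noncomputable def applyNorm {d : ℕ} (N : Option (LayerNorm d)) (p : ℕ) (x : Fin d → ℝ) :
    Fin d → ℝ :=
  match N with
  | none => x
  | some N => N.apply p x

/-- An attention head of dimension `e` on vectors of dimension `d`: query, key and value maps,
and a flag that says whether the head is causally masked. -/
structure Head (d e : ℕ) where
  query : AffineMapQ (Fin d) (Fin e)
  key : AffineMapQ (Fin d) (Fin e)
  value : AffineMapQ (Fin d) (Fin e)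
  causal : Bool

namespace Head

variable {d e : ℕ}

/-- The positions that position `i` attends to. -/
def visible (H : Head d e) {n : ℕ} (i : Fin n) : Finset (Fin n) :=
  Finset.univ.filter fun j => H.causal = true → j ≤ i

/-- A position attends at least to itself. -/
theorem visible_nonempty (H : Head d e) {n : ℕ} (i : Fin n) : (H.visible i).Nonempty :=
  ⟨i, by simp [visible]⟩

/-- The scaled dot-product score of position `j` for position `i`. -/
noncomputable def score (H : Head d e) (p : ℕ) {n : ℕ} (x : Fin n → Fin d → ℝ) (i j : Fin n) :
    ℝ :=
  rnd p (fdot p Finset.univ (H.query.apply p (x i)) (H.key.apply p (x j)) / rnd p (√(e : ℝ)))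

/-- The unnormalized attention weight of position `j` for position `i`: the weight function is
applied to the score minus the maximal score. -/
noncomputable def rawWeight (H : Head d e) (ω : UniformMap 3) (p : ℕ) {n : ℕ}
    (x : Fin n → Fin d → ℝ) (i j : Fin n) : ℝ :=
  ω.scalar p
    (rnd p (H.score p x i j - (H.visible i).sup' (H.visible_nonempty i) (H.score p x i)))

/-- The output of the head at position `i`: the average of the values of the visible positions
with the normalized attention weights. -/
noncomputable def output (H : Head d e) (ω : UniformMap 3) (p : ℕ) {n : ℕ}
    (x : Fin n → Fin d → ℝ) (i : Fin n) (k : Fin e) : ℝ :=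
  let Z := rnd p (∑ j ∈ H.visible i, H.rawWeight ω p x i j)
  fdot p (H.visible i) (fun j => rnd p (H.rawWeight ω p x i j / Z))
    (fun j => H.value.apply p (x j) k)

end Head

/-- A transformer block: multi-head attention and a feed-forward subnet with one hidden layer,
each with a residual connection and optional layer normalizations before the sublayer (pre-norm)
and after the residual connection (post-norm). -/
structure Block (d : ℕ) where
  numHeads : ℕ
  headDim : ℕ
  width : ℕ
  heads : Fin numHeads → Head d headDim
  combine : AffineMapQ (Fin numHeads × Fin headDim) (Fin d)
  inner : AffineMapQ (Fin d) (Fin width)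
  outer : AffineMapQ (Fin width) (Fin d)
  preAttention : Option (LayerNorm d)
  postAttention : Option (LayerNorm d)
  preFeedForward : Option (LayerNorm d)
  postFeedForward : Option (LayerNorm d)

/-- The map computed by a block with attention weight function `ω` and activation function `σ`
in precision `p`. -/
noncomputable def Block.apply {d : ℕ} (B : Block d) (ω σ : UniformMap 3) (p : ℕ) {n : ℕ}
    (x : Fin n → Fin d → ℝ) : Fin n → Fin d → ℝ :=
  let y : Fin n → Fin d → ℝ := fun i => applyNorm B.preAttention p (x i)
  let z : Fin n → Fin d → ℝ := fun i =>
    applyNorm B.postAttention p fun k =>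
      rnd p (x i k + B.combine.apply p (fun hk => (B.heads hk.1).output ω p y i hk.2) k)
  fun i =>
    applyNorm B.postFeedForward p fun k =>
      rnd p (z i k + B.outer.apply p
        (fun l => σ.scalar p (B.inner.apply p (applyNorm B.preFeedForward p (z i)) l)) k)

/-- A logarithmic-precision transformer classifier over the alphabet `α`. None of its parameters
depends on the length of the input. -/
structure Transformer (α : Type u) where
  /-- dimension of the model -/
  dim : ℕ
  /-- number of blocks -/
  depth : ℕ
  /-- the precision on inputs of length `n` is `precision` times the number of bits of `n` -/
  precision : ℕ
  tokenEmbedding : α → Fin dim → ℚ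
  positionEmbedding : Fin dim → UniformMap 3
  /-- weight function of the attention (for softmax: an implementation of `exp`) -/
  attentionWeight : UniformMap 3
  /-- activation function of the feed-forward subnets (for example ReLU) -/
  activation : UniformMap 3
  blocks : Fin depth → Block dim
  finalNorm : Option (LayerNorm dim)
  classifier : AffineMapQ (Fin dim) Unit

namespace Transformer

variable {α : Type u}

/-- The number of bits of precision on inputs of length `n`. -/
def bits (T : Transformer α) (n : ℕ) : ℕ := T.precision * Nat.size n

/-- The embedding layer; positions are numbered from `1`. -/
noncomputable def embed (T : Transformer α) {n : ℕ} (w : Fin n → α) (i : Fin n) (k : Fin T.dim) :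
    ℝ :=
  rnd (T.bits n) (rnd (T.bits n) (T.tokenEmbedding (w i) k) +
    (T.positionEmbedding k).position (T.bits n) n (i + 1))

/-- The output label, computed from the last position of the last layer. -/
noncomputable def classify (T : Transformer α) {n : ℕ} (x : Fin (n + 1) → Fin T.dim → ℝ) : Bool :=
  decide (0 < T.classifier.apply (T.bits (n + 1))
    (applyNorm T.finalNorm (T.bits (n + 1)) (x (Fin.last n))) ())

/-- The activations of the hidden neurons: one vector for each layer and position, layer `0`
being the embedding layer. -/
abbrev Hidden (T : Transformer α) (n : ℕ) : Type :=
  Fin (T.depth + 1) → Fin (n + 1) → Fin T.dim → ℝ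

/-- A state: an input string, the output label, and the hidden activations. -/
abbrev State (T : Transformer α) : Type u :=
  Σ n : ℕ, (Fin (n + 1) → α) × Bool × T.Hidden n

open Classical in
/-- The metric in which distinct points are at distance `1`. -/
noncomputable abbrev discreteMetric (β : Type*) : MetricSpace β where
  dist x y := if x = y then 0 else 1
  dist_self x := by simp
  dist_comm x y := by simp [eq_comm]
  dist_triangle x y z := by
    by_cases h : x = y
    · simp [h]
    · by_cases h' : x = z
      · simp only [h', if_true]; split_ifs <;> norm_num
      · simp only [h, h', if_false]; split_ifs <;> norm_num
  eq_of_dist_eq_zero {x y} h := by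
    by_contra hne
    simp [hne] at h

/-- The metric of the state space: tokens and labels are discrete, activations carry the
supremum metric, and states for inputs of different lengths are at distance at least `1`. -/
noncomputable abbrev stateMetric (T : Transformer α) : MetricSpace T.State :=
  letI : MetricSpace α := discreteMetric α
  letI : MetricSpace Bool := discreteMetric Bool
  Metric.Sigma.metricSpace

/-- One update of all neurons: the input is clamped, every layer is computed from the current
values of the previous one, and the output from the current values of the last layer. -/
noncomputable def step (T : Transformer α) : T.State → T.State
  | ⟨n, w, _, h⟩ => ⟨n, w, T.classify (h (Fin.last T.depth)),
      Fin.cases (T.embed w) fun l =>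
        (T.blocks l).apply T.attentionWeight T.activation (T.bits (n + 1)) (h l.castSucc)⟩

/-- The transformer as a candidate network: the input and output neurons are visible and the
computation time is `1`. -/
noncomputable def network (T : Transformer α) : CandidateNetwork.{u} where
  State := T.State
  metric := T.stateMetric
  Visible := Str α × Bool
  vis := fun x => (⟨x.1, x.2.1⟩, x.2.2.1)
  step := T.step
  tc := 1
  tc_pos := Nat.one_pos

/-- The encoding function: a state represents the interpretation given by its input string and
by the truth value for `α` that its output label indicates. -/
noncomputable def encoding (T : Transformer α) :
    T.network.EncodingFunction (FOM.system α).classifierSystem where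
  toFun := fun x => {T.network.vis x}
  respects := fun _ _ h => congrArg (fun v => ({v} : Set (Str α × Bool))) h

end Transformer

/-! The input is clamped and the layers settle one after another, so after finitely many updates
every trajectory rests at the state computed from its input string (`iterate_step`). Hence the limit
points are exactly these fixed states, the network is stable, and it represents the graph of the
function `label`. A sentence that defines `label` then has exactly the represented interpretations
as the models of its classifier, and the entailment condition holds by definition. What remains is
to define `label` in FO(M).

Let n be the length of the string. Logarithmic precision makes `2 ^ p` polynomial in n, so
activations are polynomially bounded integers in units of `2 ^ (-p)`, and values before rounding are
quotients of such integers or square roots of such quotients. These integers are written with a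
fixed number of digits in a base b that is a power of two with b ^ 3 ≤ n ≤ b ^ 6. A digit is itself
a position, and it can be read off a position as a block of bits.

The heart is iterated addition. The sum of b digits is the number of certain pairs of digits; since
2 * b ^ 2 ≤ n, the pairs are coded in the first half of the positions, where a majority quantifier
can compare the count with any threshold by padding from the second half
(`DefinableFun.card_filter_lt`). Summing each column and then adding the constantly many shifted
columns gives `DigitDefinable.sum_base`, and iteration gives sums of polynomial length
(`Feasible.sum_range`).

Bounded summation yields everything else: products, truncated differences, bounded quantifiers,
search, and so all lower elementary functions. Rounding is a bounded search for the greatest float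
below a value and needs only comparisons with integers, which for square roots are made after
squaring. The transformer is a fixed composition of such operations. Strings of length below 8,
where the base could be trivial, are finitely many and are treated by a table. -/

namespace FOM

variable {α : Type u}

/-! ## Definable relations on the positions of a string -/

theorem Term.exists_rename {k m : ℕ} (ρ : Fin k → Fin m) (t : Term k) :
    ∃ t' : Term m, ∀ n v, t'.eval n v = t.eval n (v ∘ ρ) := by
  induction t with
  | var i => exact ⟨.var (ρ i), fun _ _ => rfl⟩
  | one => exact ⟨.one, fun _ _ => rfl⟩
  | len => exact ⟨.len, fun _ _ => rfl⟩
  | add s t hs ht =>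
    obtain ⟨s', hs⟩ := hs
    obtain ⟨t', ht⟩ := ht
    exact ⟨.add s' t', fun n v => by simp only [Term.eval, hs, ht]⟩
  | sub s t hs ht =>
    obtain ⟨s', hs⟩ := hs
    obtain ⟨t', ht⟩ := ht
    exact ⟨.sub s' t', fun n v => by simp only [Term.eval, hs, ht]⟩

theorem snoc_comp_snoc_castSucc {k m : ℕ} (ρ : Fin k → Fin m) (v : Fin m → ℕ) (x : ℕ) :
    (Fin.snoc (α := fun _ => ℕ) v x ∘
      Fin.snoc (α := fun _ => Fin (m + 1)) (Fin.castSucc ∘ ρ) (Fin.last m)) =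
      Fin.snoc (α := fun _ => ℕ) (v ∘ ρ) x := by
  funext i
  refine Fin.lastCases ?_ (fun i => ?_) i <;> simp

open Classical in
-- A quantifier binds the last variable, so under it the renaming is extended by sending the old
-- last variable to the new one. This provides the weakening on which all substitutions below rest.
theorem Formula.exists_rename {k : ℕ} (φ : Formula α k) :
    ∀ {m : ℕ} (ρ : Fin k → Fin m),
      ∃ φ' : Formula α m, ∀ w v, φ'.Sat w v ↔ φ.Sat w (v ∘ ρ) := by
  induction φ with
  | token a t =>
    intro m ρ
    obtain ⟨t', ht⟩ := t.exists_rename ρ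
    exact ⟨.token a t', fun w v => by simp only [Formula.Sat, ht]⟩
  | eq s t =>
    intro m ρ
    obtain ⟨s', hs⟩ := s.exists_rename ρ
    obtain ⟨t', ht⟩ := t.exists_rename ρ
    exact ⟨.eq s' t', fun w v => by simp only [Formula.Sat, hs, ht]⟩
  | le s t =>
    intro m ρ
    obtain ⟨s', hs⟩ := s.exists_rename ρ
    obtain ⟨t', ht⟩ := t.exists_rename ρ
    exact ⟨.le s' t', fun w v => by simp only [Formula.Sat, hs, ht]⟩
  | bit s t =>
    intro m ρ
    obtain ⟨s', hs⟩ := s.exists_rename ρ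
    obtain ⟨t', ht⟩ := t.exists_rename ρ
    exact ⟨.bit s' t', fun w v => by simp only [Formula.Sat, hs, ht]⟩
  | not φ ih =>
    intro m ρ
    obtain ⟨φ', h⟩ := ih ρ
    exact ⟨.not φ', fun w v => by simp only [Formula.Sat, h]⟩
  | and φ ψ ih ih' =>
    intro m ρ
    obtain ⟨φ', h⟩ := ih ρ
    obtain ⟨ψ', h'⟩ := ih' ρ
    exact ⟨.and φ' ψ', fun w v => by simp only [Formula.Sat, h, h']⟩
  | or φ ψ ih ih' =>
    intro m ρ
    obtain ⟨φ', h⟩ := ih ρ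
    obtain ⟨ψ', h'⟩ := ih' ρ
    exact ⟨.or φ' ψ', fun w v => by simp only [Formula.Sat, h, h']⟩
  | ex φ ih =>
    intro m ρ
    obtain ⟨φ', h⟩ := ih (Fin.snoc (α := fun _ => Fin (m + 1)) (Fin.castSucc ∘ ρ) (Fin.last m))
    exact ⟨.ex φ', fun w v => by simp only [Formula.Sat, h, snoc_comp_snoc_castSucc]⟩
  | all φ ih =>
    intro m ρ
    obtain ⟨φ', h⟩ := ih (Fin.snoc (α := fun _ => Fin (m + 1)) (Fin.castSucc ∘ ρ) (Fin.last m))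
    exact ⟨.all φ', fun w v => by simp only [Formula.Sat, h, snoc_comp_snoc_castSucc]⟩
  | maj φ ih =>
    intro m ρ
    obtain ⟨φ', h⟩ := ih (Fin.snoc (α := fun _ => Fin (m + 1)) (Fin.castSucc ∘ ρ) (Fin.last m))
    refine ⟨.maj φ', fun w v => ?_⟩
    simp only [Formula.Sat]
    rw [Finset.filter_congr fun x _ => by rw [h, snoc_comp_snoc_castSucc]]

/-- `v` assigns positions of `w`, numbered from `0`, to the variables. -/
def Valid {k : ℕ} (w : Str α) (v : Fin k → ℕ) : Prop := 7 ≤ w.1 ∧ ∀ i, v i ≤ w.1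

/-- A relation between positions, numbered from `0`, that is defined by a formula on all strings
of length at least `8`. -/
def Definable {k : ℕ} (R : Str α → (Fin k → ℕ) → Prop) : Prop :=
  ∃ φ : Formula α k, ∀ w v, Valid w v → (φ.Sat w (fun i => v i + 1) ↔ R w v)

/-- A function of positions that is the value of an index term. -/
def IsTerm {k : ℕ} (f : Str α → (Fin k → ℕ) → ℕ) : Prop :=
  ∃ t : Term k, ∀ w v, t.eval (w.1 + 1) (fun i => v i + 1) = (f w v : ℤ)

theorem Valid.snoc {k : ℕ} {w : Str α} {v : Fin k → ℕ} (hv : Valid w v) {x : ℕ} (hx : x ≤ w.1) :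
    Valid w (Fin.snoc (α := fun _ => ℕ) v x) := by
  refine ⟨hv.1, fun i => ?_⟩
  refine Fin.lastCases ?_ (fun i => ?_) i
  · simpa using hx
  · simpa using hv.2 i

theorem Valid.comp {k m : ℕ} {w : Str α} {v : Fin m → ℕ} (hv : Valid w v) (ρ : Fin k → Fin m) :
    Valid w (fun i => v (ρ i)) := ⟨hv.1, fun i => hv.2 (ρ i)⟩

theorem snoc_add_one {k : ℕ} (v : Fin k → ℕ) (x : ℕ) :
    Fin.snoc (α := fun _ => ℕ) (fun i => v i + 1) (x + 1) =
      fun i => Fin.snoc (α := fun _ => ℕ) v x i + 1 := by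
  funext i
  refine Fin.lastCases ?_ (fun i => ?_) i <;> simp

/-! ### Index terms and atomic relations -/

section IsTerm

variable {k : ℕ} {f g : Str α → (Fin k → ℕ) → ℕ}

theorem IsTerm.var (i : Fin k) : IsTerm (fun (_ : Str α) v => v i) :=
  ⟨.sub (.var i) .one, fun w v => by simp [Term.eval]⟩

theorem IsTerm.zero : IsTerm (fun (_ : Str α) (_ : Fin k → ℕ) => 0) :=
  ⟨.sub .one .one, fun w v => by simp [Term.eval]⟩

theorem IsTerm.one : IsTerm (fun (_ : Str α) (_ : Fin k → ℕ) => 1) :=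
  ⟨.one, fun w v => by simp [Term.eval]⟩

theorem IsTerm.last : IsTerm (fun (w : Str α) (_ : Fin k → ℕ) => w.1) :=
  ⟨.sub .len .one, fun w v => by simp [Term.eval]⟩

theorem IsTerm.add (hf : IsTerm f) (hg : IsTerm g) : IsTerm (fun w v => f w v + g w v) := by
  obtain ⟨s, hs⟩ := hf
  obtain ⟨t, ht⟩ := hg
  exact ⟨.add s t, fun w v => by simp [Term.eval, hs, ht]⟩

theorem IsTerm.succ (hf : IsTerm f) : IsTerm (fun w v => f w v + 1) := hf.add .one

theorem IsTerm.nsmul (hf : IsTerm f) (c : ℕ) : IsTerm (fun w v => c * f w v) := by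
  induction c with
  | zero => simpa using IsTerm.zero
  | succ c ih => simpa only [Nat.succ_mul] using ih.add hf

theorem IsTerm.rename {m : ℕ} (hf : IsTerm f) (ρ : Fin k → Fin m) :
    IsTerm (fun w v => f w (fun i => v (ρ i))) := by
  obtain ⟨s, hs⟩ := hf
  obtain ⟨t, ht⟩ := s.exists_rename ρ
  exact ⟨t, fun w v => (ht _ _).trans (hs _ _)⟩

theorem IsTerm.le (hf : IsTerm f) (hg : IsTerm g) : Definable (fun w v => f w v ≤ g w v) := by
  obtain ⟨s, hs⟩ := hf
  obtain ⟨t, ht⟩ := hg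
  exact ⟨.le s t, fun w v _ => by simp [Formula.Sat, hs, ht]⟩

theorem IsTerm.lt (hf : IsTerm f) (hg : IsTerm g) : Definable (fun w v => f w v < g w v) :=
  hf.succ.le hg

theorem IsTerm.eq (hf : IsTerm f) (hg : IsTerm g) : Definable (fun w v => f w v = g w v) := by
  obtain ⟨s, hs⟩ := hf
  obtain ⟨t, ht⟩ := hg
  exact ⟨.eq s t, fun w v _ => by simp [Formula.Sat, hs, ht]⟩

theorem IsTerm.testBit (hf : IsTerm f) (hg : IsTerm g) :
    Definable (fun w v => (f w v).testBit (g w v) = true) := by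
  obtain ⟨s, hs⟩ := hf
  obtain ⟨t, ht⟩ := hg
  exact ⟨.bit s t, fun w v _ => by simp [Formula.Sat, hs, ht]⟩

theorem IsTerm.token (hf : IsTerm f) (a : α) :
    Definable (fun w v => ∃ p : Fin (w.1 + 1), f w v = p ∧ w.2 p = a) := by
  obtain ⟨s, hs⟩ := hf
  refine ⟨.token a (.add s .one), fun w v _ => ?_⟩
  simp only [Formula.Sat, Term.eval, hs]
  exact exists_congr fun p => and_congr_left' (by omega)

end IsTerm

/-! ### Closure of definable relations under connectives and quantifiers -/

namespace Definable

variable {k m : ℕ} {R S : Str α → (Fin k → ℕ) → Prop}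

theorem congr (hR : Definable R) (h : ∀ w v, Valid w v → (R w v ↔ S w v)) : Definable S := by
  obtain ⟨φ, hφ⟩ := hR
  exact ⟨φ, fun w v hv => (hφ w v hv).trans (h w v hv)⟩

theorem not (hR : Definable R) : Definable (fun w v => ¬ R w v) := by
  obtain ⟨φ, hφ⟩ := hR
  exact ⟨.not φ, fun w v hv => not_congr (hφ w v hv)⟩

theorem and (hR : Definable R) (hS : Definable S) : Definable (fun w v => R w v ∧ S w v) := by
  obtain ⟨φ, hφ⟩ := hR
  obtain ⟨ψ, hψ⟩ := hS
  exact ⟨.and φ ψ, fun w v hv => and_congr (hφ w v hv) (hψ w v hv)⟩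

theorem or (hR : Definable R) (hS : Definable S) : Definable (fun w v => R w v ∨ S w v) := by
  obtain ⟨φ, hφ⟩ := hR
  obtain ⟨ψ, hψ⟩ := hS
  exact ⟨.or φ ψ, fun w v hv => or_congr (hφ w v hv) (hψ w v hv)⟩

theorem imp (hR : Definable R) (hS : Definable S) : Definable (fun w v => R w v → S w v) :=
  (hR.not.or hS).congr fun _ _ _ => imp_iff_not_or.symm

theorem iff (hR : Definable R) (hS : Definable S) : Definable (fun w v => R w v ↔ S w v) :=
  ((hR.imp hS).and (hS.imp hR)).congr fun _ _ _ => iff_iff_implies_and_implies.symm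

theorem const (P : Prop) : Definable (fun (_ : Str α) (_ : Fin k → ℕ) => P) := by
  by_cases h : P
  · exact (IsTerm.zero.eq IsTerm.zero).congr fun _ _ _ => by simp [h]
  · exact (IsTerm.zero.eq IsTerm.one).congr fun _ _ _ => by simp [h]

theorem rename (hR : Definable R) (ρ : Fin k → Fin m) :
    Definable (fun w v => R w (fun i => v (ρ i))) := by
  obtain ⟨φ, hφ⟩ := hR
  obtain ⟨φ', h⟩ := φ.exists_rename ρ
  exact ⟨φ', fun w v hv => (h w _).trans (hφ w _ (hv.comp ρ))⟩

theorem exists_le {R : Str α → (Fin k → ℕ) → ℕ → Prop}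
    (hR : Definable fun w (v : Fin (k + 1) → ℕ) => R w (fun i => v i.castSucc) (v (Fin.last k))) :
    Definable (fun w v => ∃ x ≤ w.1, R w v x) := by
  obtain ⟨φ, hφ⟩ := hR
  refine ⟨.ex φ, fun w v hv => ?_⟩
  have key : ∀ x ≤ w.1,
      (φ.Sat w (Fin.snoc (α := fun _ => ℕ) (fun i => v i + 1) (x + 1)) ↔ R w v x) := by
    intro x hx
    rw [snoc_add_one, hφ w _ (hv.snoc hx)]
    simp
  simp only [Formula.Sat, Finset.mem_Icc]
  constructor
  · rintro ⟨x, ⟨h1, h2⟩, h⟩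
    obtain ⟨x, rfl⟩ := Nat.exists_eq_add_of_le' h1
    exact ⟨x, by omega, (key x (by omega)).1 h⟩
  · rintro ⟨x, h1, h⟩
    exact ⟨x + 1, ⟨by omega, by omega⟩, (key x h1).2 h⟩

theorem forall_le {R : Str α → (Fin k → ℕ) → ℕ → Prop}
    (hR : Definable fun w (v : Fin (k + 1) → ℕ) => R w (fun i => v i.castSucc) (v (Fin.last k))) :
    Definable (fun w v => ∀ x ≤ w.1, R w v x) :=
  (exists_le (R := fun w v x => ¬ R w v x) hR.not).not.congr fun _ _ _ => by push Not; rfl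

theorem majority {R : Str α → (Fin k → ℕ) → ℕ → Prop} [∀ w v, DecidablePred (R w v)]
    (hR : Definable fun w (v : Fin (k + 1) → ℕ) => R w (fun i => v i.castSucc) (v (Fin.last k))) :
    Definable (fun w v => w.1 + 1 < 2 * ((Finset.range (w.1 + 1)).filter (R w v)).card) := by
  obtain ⟨φ, hφ⟩ := hR
  refine ⟨.maj φ, fun w v hv => ?_⟩
  have key : ∀ x ≤ w.1,
      (φ.Sat w (Fin.snoc (α := fun _ => ℕ) (fun i => v i + 1) (x + 1)) ↔ R w v x) := by
    intro x hx
    rw [snoc_add_one, hφ w _ (hv.snoc hx)]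
    simp
  classical
  simp only [Formula.Sat]
  have : ((Finset.Icc 1 (w.1 + 1)).filter fun x =>
      φ.Sat w (Fin.snoc (α := fun _ => ℕ) (fun i => v i + 1) x)) =
      ((Finset.range (w.1 + 1)).filter (R w v)).map ⟨Nat.succ, Nat.succ_injective⟩ := by
    ext x
    simp only [Finset.mem_filter, Finset.mem_Icc, Finset.mem_map, Finset.mem_range,
      Function.Embedding.coeFn_mk]
    constructor
    · rintro ⟨⟨h1, h2⟩, h⟩
      obtain ⟨x, rfl⟩ := Nat.exists_eq_add_of_le' h1
      exact ⟨x, ⟨by omega, (key x (by omega)).1 h⟩, rfl⟩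
    · rintro ⟨x, ⟨h1, h⟩, rfl⟩
      exact ⟨⟨by omega, by omega⟩, (key x (by omega)).2 h⟩
  rw [this, Finset.card_map]

end Definable

/-- A function from positions to positions with a definable graph. -/
structure DefinableFun {k : ℕ} (f : Str α → (Fin k → ℕ) → ℕ) : Prop where
  le : ∀ w v, Valid w v → f w v ≤ w.1
  graph : Definable fun w (v : Fin (k + 1) → ℕ) => f w (fun i => v i.castSucc) = v (Fin.last k)

theorem DefinableFun.rename {k m : ℕ} {f : Str α → (Fin k → ℕ) → ℕ} (hf : DefinableFun f)
    (ρ : Fin k → Fin m) : DefinableFun (fun w v => f w (fun i => v (ρ i))) := by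
  refine ⟨fun w v hv => hf.le w _ (hv.comp ρ), ?_⟩
  refine (hf.graph.rename
    (Fin.snoc (α := fun _ => Fin (m + 1)) (Fin.castSucc ∘ ρ) (Fin.last m))).congr ?_
  intro w v _
  simp

theorem DefinableFun.congr {k : ℕ} {f g : Str α → (Fin k → ℕ) → ℕ} (hf : DefinableFun f)
    (h : ∀ w v, Valid w v → f w v = g w v) : DefinableFun g :=
  ⟨fun w v hv => h w v hv ▸ hf.le w v hv,
    hf.graph.congr fun w v hv => by rw [h w _ (hv.comp Fin.castSucc)]⟩

theorem IsTerm.definableFun {k : ℕ} {f : Str α → (Fin k → ℕ) → ℕ}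
    (hf : IsTerm fun w (v : Fin (k + 1) → ℕ) => f w (fun i => v i.castSucc))
    (hle : ∀ w v, Valid w v → f w v ≤ w.1) : DefinableFun f :=
  ⟨hle, hf.eq (IsTerm.var _)⟩

/-- The value of `f` is a position, so it can be named by an existential quantifier and tied to `f`
by the graph. -/
theorem Definable.subst {k : ℕ} {R : Str α → (Fin k → ℕ) → ℕ → Prop}
    {f : Str α → (Fin k → ℕ) → ℕ}
    (hR : Definable fun w (v : Fin (k + 1) → ℕ) => R w (fun i => v i.castSucc) (v (Fin.last k)))
    (hf : DefinableFun f) : Definable (fun w v => R w v (f w v)) :=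
  (Definable.exists_le (R := fun w v x => f w v = x ∧ R w v x) (hf.graph.and hR)).congr
    fun w v hv => ⟨by rintro ⟨x, -, rfl, h⟩; exact h, fun h => ⟨_, hf.le w v hv, rfl, h⟩⟩

theorem Definable.subst₂ {k : ℕ} {R : Str α → (Fin k → ℕ) → ℕ → ℕ → Prop}
    {f g : Str α → (Fin k → ℕ) → ℕ}
    (hR : Definable fun w (v : Fin (k + 2) → ℕ) =>
      R w (fun i => v i.castSucc.castSucc) (v (Fin.last k).castSucc) (v (Fin.last (k + 1))))
    (hf : DefinableFun f) (hg : DefinableFun g) :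
    Definable (fun w v => R w v (f w v) (g w v)) :=
  Definable.subst (R := fun w v x => R w v x (g w v))
    (Definable.subst (R := fun w (v : Fin (k + 1) → ℕ) y =>
      R w (fun i => v i.castSucc) (v (Fin.last k)) y) hR (hg.rename Fin.castSucc)) hf

theorem Definable.subst₃ {k : ℕ} {R : Str α → (Fin k → ℕ) → ℕ → ℕ → ℕ → Prop}
    {f g h : Str α → (Fin k → ℕ) → ℕ}
    (hR : Definable fun w (v : Fin (k + 3) → ℕ) =>
      R w (fun i => v i.castSucc.castSucc.castSucc) (v (Fin.last k).castSucc.castSucc)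
        (v (Fin.last (k + 1)).castSucc) (v (Fin.last (k + 2))))
    (hf : DefinableFun f) (hg : DefinableFun g) (hh : DefinableFun h) :
    Definable (fun w v => R w v (f w v) (g w v) (h w v)) :=
  Definable.subst₂ (R := fun w v x y => R w v x y (h w v))
    (Definable.subst (R := fun w (v : Fin (k + 2) → ℕ) y =>
      R w (fun i => v i.castSucc.castSucc) (v (Fin.last k).castSucc) (v (Fin.last (k + 1))) y) hR
      (hh.rename fun i => i.castSucc.castSucc)) hf hg

end FOM

namespace FOM

variable {α : Type u}

/-! ## Digits -/

/-- The length of a digit in bits. -/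
def shift (w : Str α) : ℕ := Nat.log 2 (w.1 + 1) / 3

/-- The base in which numbers are represented by tuples of positions. -/
def base (w : Str α) : ℕ := 2 ^ shift w

theorem one_le_shift {w : Str α} (h : 7 ≤ w.1) : 1 ≤ shift w := by
  have : 3 ≤ Nat.log 2 (w.1 + 1) := Nat.le_log_of_pow_le (by norm_num) (by omega)
  unfold shift
  omega

theorem base_pos (w : Str α) : 0 < base w := by unfold base; positivity

theorem two_le_base {w : Str α} (h : 7 ≤ w.1) : 2 ≤ base w :=
  Nat.pow_le_pow_right (n := 2) (by norm_num) (one_le_shift h)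

theorem base_pow_three_le (w : Str α) : base w ^ 3 ≤ w.1 + 1 := by
  unfold base
  rw [← pow_mul]
  calc 2 ^ (shift w * 3) ≤ 2 ^ Nat.log 2 (w.1 + 1) :=
        Nat.pow_le_pow_right (by norm_num) (Nat.div_mul_le_self _ _)
    _ ≤ _ := Nat.pow_log_le_self _ (by omega)

/-- Leaves room for all pairs of digits in the first half of the positions, as counting by majority
requires. -/
theorem two_mul_base_sq_le {w : Str α} (h : 7 ≤ w.1) : 2 * base w ^ 2 ≤ w.1 + 1 := by
  have := base_pow_three_le w
  have := two_le_base h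
  nlinarith [sq_nonneg (base w)]

theorem base_le {w : Str α} (h : 7 ≤ w.1) : base w ≤ w.1 := by
  have := two_mul_base_sq_le h
  have := two_le_base h
  nlinarith

/-- With s = `shift w` ≥ 1 the logarithm is at most 3s + 2, and 3s + 3 ≤ 6s. So every position has
six digits. -/
theorem lt_base_pow_six {w : Str α} (h : 7 ≤ w.1) : w.1 < base w ^ 6 := by
  unfold base
  rw [← pow_mul]
  have h1 : w.1 + 1 < 2 ^ (Nat.log 2 (w.1 + 1) + 1) := Nat.lt_pow_succ_log_self (by norm_num) _
  have h2 : 2 ^ (Nat.log 2 (w.1 + 1) + 1) ≤ 2 ^ (shift w * 6) := by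
    refine Nat.pow_le_pow_right (by norm_num) ?_
    have := one_le_shift h
    unfold shift at *
    omega
  omega

theorem shift_le (w : Str α) : 3 * shift w ≤ w.1 := by
  have : Nat.log 2 (w.1 + 1) < w.1 + 1 := Nat.log_lt_self 2 (by omega)
  unfold shift
  omega

theorem testBit_false_of_le {x t w : ℕ} (hx : x ≤ w) (ht : w < t) : x.testBit t = false :=
  Nat.testBit_lt_two_pow (by
    have := Nat.lt_two_pow_self (n := t)
    omega)

/-- The logarithm is the index of the highest bit that is set in the length. -/
theorem definableFun_log {k : ℕ} :
    DefinableFun (fun (w : Str α) (_ : Fin k → ℕ) => Nat.log 2 (w.1 + 1)) := by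
  refine ⟨fun w v _ => Nat.le_of_lt_succ (Nat.log_lt_self 2 (by omega)), ?_⟩
  have h : Definable fun (w : Str α) (v : Fin (k + 1) → ℕ) =>
      (w.1 + 1).testBit (v (Fin.last k)) = true ∧
        ∀ t ≤ w.1, (w.1 + 1).testBit t = true → t ≤ v (Fin.last k) :=
    (IsTerm.last.succ.testBit (.var _)).and (Definable.forall_le
      (R := fun (w : Str α) (v : Fin (k + 1) → ℕ) t =>
        (w.1 + 1).testBit t = true → t ≤ v (Fin.last k))
      ((IsTerm.last.succ.testBit (.var _)).imp ((IsTerm.var _).le (.var _))))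
  refine h.congr fun w v hv => ?_
  have h0 : (w.1 + 1).testBit (Nat.log 2 (w.1 + 1)) = true := by
    rw [Nat.testBit_eq_decide_div_mod_eq, Nat.div_eq_of_lt_le (k := 1)]
    · simp
    · simpa using Nat.pow_log_le_self 2 (x := w.1 + 1) (by omega)
    · have := Nat.lt_pow_succ_log_self (b := 2) (by norm_num) (w.1 + 1)
      rw [pow_succ] at this
      omega
  have h1 : ∀ t, (w.1 + 1).testBit t = true → t ≤ Nat.log 2 (w.1 + 1) := fun t ht =>
    Nat.le_log_of_pow_le (by norm_num) (Nat.ge_two_pow_of_testBit ht)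
  constructor
  · rintro ⟨h2, h3⟩
    exact le_antisymm (h3 _ (Nat.le_of_lt_succ (Nat.log_lt_self 2 (by omega))) h0) (h1 _ h2)
  · rintro h
    rw [← h]
    exact ⟨h0, fun t _ => h1 t⟩

theorem definableFun_shift {k : ℕ} :
    DefinableFun (fun (w : Str α) (_ : Fin k → ℕ) => shift w) := by
  refine ⟨fun w v _ => by have := shift_le w; omega, ?_⟩
  have h : Definable fun (w : Str α) (v : Fin (k + 1) → ℕ) =>
      3 * v (Fin.last k) ≤ Nat.log 2 (w.1 + 1) ∧
        Nat.log 2 (w.1 + 1) < 3 * v (Fin.last k) + 3 :=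
    Definable.subst (R := fun (w : Str α) (v : Fin (k + 1) → ℕ) t =>
        3 * v (Fin.last k) ≤ t ∧ t < 3 * v (Fin.last k) + 3)
      ((((IsTerm.var _).nsmul 3).le (.var _)).and
        ((IsTerm.var _).lt (((IsTerm.var _).nsmul 3).add (IsTerm.one.nsmul 3)))) definableFun_log
  refine h.congr fun w v hv => ?_
  unfold shift
  omega

/-- A number given by its bits. -/
theorem DefinableFun.of_testBit {k : ℕ} {f : Str α → (Fin k → ℕ) → ℕ}
    {B : Str α → (Fin k → ℕ) → ℕ → Prop}
    (hB : Definable fun w (v : Fin (k + 1) → ℕ) => B w (fun i => v i.castSucc) (v (Fin.last k)))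
    (hle : ∀ w v, Valid w v → f w v ≤ w.1)
    (h : ∀ w v, Valid w v → ∀ t ≤ w.1, ((f w v).testBit t = true ↔ B w v t)) :
    DefinableFun f := by
  refine ⟨hle, ?_⟩
  have h1 : Definable fun w (v : Fin (k + 1) → ℕ) =>
      ∀ t ≤ w.1, ((v (Fin.last k)).testBit t = true ↔ B w (fun i => v i.castSucc) t) := by
    refine Definable.forall_le (R := fun w (v : Fin (k + 1) → ℕ) t =>
      ((v (Fin.last k)).testBit t = true ↔ B w (fun i => v i.castSucc) t)) ?_
    refine ((IsTerm.var _).testBit (.var _)).iff ?_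
    refine (hB.rename (Fin.snoc (α := fun _ => Fin (k + 2)) (fun i => i.castSucc.castSucc)
      (Fin.last (k + 1)))).congr fun w v _ => ?_
    simp
  refine h1.congr fun w v hv => ?_
  have hv' : Valid w (fun i => v i.castSucc) := hv.comp Fin.castSucc
  constructor
  · intro h2
    refine Nat.eq_of_testBit_eq fun t => ?_
    rcases le_or_gt t w.1 with ht | ht
    · rw [Bool.eq_iff_iff, h w _ hv' t ht, h2 t ht]
    -- Bits with an index beyond the last position vanish on both sides, so comparing bits at
    -- positions is enough.
    · rw [testBit_false_of_le (hle w _ hv') ht, testBit_false_of_le (hv.2 _) ht]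
  · intro h2 t ht
    rw [← h2, h w _ hv' t ht]

theorem definableFun_base {k : ℕ} :
    DefinableFun (fun (w : Str α) (_ : Fin k → ℕ) => base w) := by
  refine DefinableFun.of_testBit (B := fun w _ t => shift w = t) definableFun_shift.graph
    (fun w v hv => base_le hv.1) fun w v hv t _ => ?_
  rw [base, Nat.testBit_two_pow]
  simp

/-- The base is a power of two, so digit `j` is the block of `shift w` bits that starts at bit `j *
shift w`. No multiplication of positions is involved, because `j` is a fixed number. -/
theorem IsTerm.digit {k : ℕ} {f : Str α → (Fin k → ℕ) → ℕ} (hf : IsTerm f) (j : ℕ) :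
    DefinableFun (fun w v => f w v / base w ^ j % base w) := by
  refine DefinableFun.of_testBit
    (B := fun w v t => t < shift w ∧ (f w v).testBit (j * shift w + t) = true) ?_
    (fun w v hv => ?_) fun w v hv t _ => ?_
  · refine Definable.subst (R := fun w (v : Fin (k + 1) → ℕ) s => v (Fin.last k) < s ∧
      (f w (fun i => v i.castSucc)).testBit (j * s + v (Fin.last k)) = true) ?_ definableFun_shift
    exact ((IsTerm.var _).lt (.var _)).and
      ((hf.rename fun i => i.castSucc.castSucc).testBit (((IsTerm.var _).nsmul j).add (.var _)))
  · exact ((Nat.mod_lt _ (base_pos w)).trans_le (base_le hv.1)).le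
  · rw [base, ← pow_mul, Nat.testBit_mod_two_pow, Nat.testBit_div_two_pow, mul_comm, add_comm]
    simp

/-- The majority quantifier only tests against half of the length. With h = (w.1 + 1) / 2 and a
count C ≤ h in the first half, adding h + 1 - y further positions from the second half turns this
test into y ≤ C, for either parity of the length. -/
theorem DefinableFun.card_filter_lt {k : ℕ} {R : Str α → (Fin k → ℕ) → ℕ → Prop}
    [∀ w v, DecidablePred (R w v)]
    (hR : Definable fun w (v : Fin (k + 1) → ℕ) => R w (fun i => v i.castSucc) (v (Fin.last k))) :
    DefinableFun fun w v => ((Finset.range ((w.1 + 1) / 2)).filter (R w v)).card := by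
  have hle : ∀ w v, ((Finset.range ((w.1 + 1) / 2)).filter (R w v)).card ≤ (w.1 + 1) / 2 :=
    fun w v => (Finset.card_filter_le _ _).trans (by simp)
  refine ⟨fun w v hv => (hle w v).trans (by have := hv.1; omega), ?_⟩
  have half : ∀ {m : ℕ}, DefinableFun fun (w : Str α) (_ : Fin m → ℕ) => (w.1 + 1) / 2 := by
    intro m
    refine ⟨fun w v hv => by have := hv.1; omega, ?_⟩
    refine ((((IsTerm.var (Fin.last m)).nsmul 2).le IsTerm.last.succ).and
      (IsTerm.last.lt (((IsTerm.var (Fin.last m)).nsmul 2).succ))).congr fun w v hv => ?_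
    omega
  have h1 : ∀ c, Definable fun w (v : Fin (k + 1) → ℕ) =>
      w.1 + 1 < 2 * ((Finset.range (w.1 + 1)).filter fun x =>
        (x < (w.1 + 1) / 2 ∧ R w (fun i => v i.castSucc) x) ∨
        ((w.1 + 1) / 2 ≤ x ∧ x + (v (Fin.last k) + c * 1) ≤ 2 * ((w.1 + 1) / 2))).card := by
    intro c
    refine Definable.majority (R := fun w (v : Fin (k + 1) → ℕ) x =>
        (x < (w.1 + 1) / 2 ∧ R w (fun i => v i.castSucc) x) ∨
        ((w.1 + 1) / 2 ≤ x ∧ x + (v (Fin.last k) + c * 1) ≤ 2 * ((w.1 + 1) / 2))) ?_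
    refine Definable.subst (R := fun w (v : Fin (k + 2) → ℕ) h =>
        (v (Fin.last (k + 1)) < h ∧ R w (fun i => v i.castSucc.castSucc) (v (Fin.last (k + 1)))) ∨
        (h ≤ v (Fin.last (k + 1)) ∧
          v (Fin.last (k + 1)) + (v (Fin.last k).castSucc + c * 1) ≤ 2 * h))
      (Definable.or (.and ((IsTerm.var _).lt (.var _)) ?_)
        (((IsTerm.var _).le (.var _)).and
          (((IsTerm.var _).add ((IsTerm.var _).add (IsTerm.one.nsmul c))).le
            ((IsTerm.var _).nsmul 2)))) half
    refine (hR.rename (Fin.snoc (α := fun _ => Fin (k + 3))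
      (fun i => i.castSucc.castSucc.castSucc) (Fin.last (k + 1)).castSucc)).congr fun w v _ => ?_
    simp
  have key : ∀ (w : Str α) (v : Fin k → ℕ) (y : ℕ), 1 ≤ y →
      (w.1 + 1 < 2 * ((Finset.range (w.1 + 1)).filter fun x =>
        (x < (w.1 + 1) / 2 ∧ R w v x) ∨
        ((w.1 + 1) / 2 ≤ x ∧ x + y ≤ 2 * ((w.1 + 1) / 2))).card ↔
      y ≤ ((Finset.range ((w.1 + 1) / 2)).filter (R w v)).card) := by
    intro w v y hy
    have h2 : ((Finset.range (w.1 + 1)).filter fun x =>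
        (x < (w.1 + 1) / 2 ∧ R w v x) ∨
        ((w.1 + 1) / 2 ≤ x ∧ x + y ≤ 2 * ((w.1 + 1) / 2))) =
        (Finset.range ((w.1 + 1) / 2)).filter (R w v) ∪
          Finset.Ico ((w.1 + 1) / 2) (2 * ((w.1 + 1) / 2) + 1 - y) := by
      ext x
      simp only [Finset.mem_filter, Finset.mem_range, Finset.mem_union, Finset.mem_Ico]
      constructor
      · rintro ⟨_, h | h⟩
        · exact .inl h
        · exact .inr (by omega)
      · rintro (h | h)
        · exact ⟨by omega, .inl h⟩
        · exact ⟨by omega, .inr (by omega)⟩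
    rw [h2, Finset.card_union_of_disjoint, Nat.card_Ico]
    · have := hle w v
      omega
    · rw [Finset.disjoint_left]
      intro x hx hx'
      simp only [Finset.mem_filter, Finset.mem_range, Finset.mem_Ico] at hx hx'
      omega
  -- The count equals y iff it is at least y and not at least y + 1. The threshold 0 is split off,
  -- since for it the padding h + 1 - y might not fit into the second half.
  refine ((((IsTerm.var (Fin.last k)).eq IsTerm.zero).or (h1 0)).and (h1 1).not).congr fun w v hv => ?_
  have k1 := key w (fun i => v i.castSucc) (v (Fin.last k) + 1) (by omega)
  simp only [zero_mul, add_zero, one_mul]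
  rw [k1]
  rcases Nat.eq_zero_or_pos (v (Fin.last k)) with h0 | h0
  · simp only [h0, true_or, true_and]
    omega
  · rw [key w (fun i => v i.castSucc) _ h0]
    omega

/-! ## Numbers represented by tuples of digits -/

/-- A function from positions to polynomially bounded numbers that has definable digits. -/
structure DigitDefinable {k : ℕ} (f : Str α → (Fin k → ℕ) → ℕ) : Prop where
  lt : ∃ c, ∀ w v, Valid w v → f w v < base w ^ c
  digit : ∀ j, DefinableFun fun w v => f w v / base w ^ j % base w

namespace DigitDefinable

variable {k m : ℕ} {f g : Str α → (Fin k → ℕ) → ℕ}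

theorem congr (hf : DigitDefinable f) (h : ∀ w v, Valid w v → f w v = g w v) :
    DigitDefinable g := by
  obtain ⟨⟨c, hc⟩, hd⟩ := hf
  exact ⟨⟨c, fun w v hv => h w v hv ▸ hc w v hv⟩,
    fun j => (hd j).congr fun w v hv => by rw [h w v hv]⟩

theorem rename (hf : DigitDefinable f) (ρ : Fin k → Fin m) :
    DigitDefinable (fun w v => f w (fun i => v (ρ i))) := by
  obtain ⟨⟨c, hc⟩, hd⟩ := hf
  exact ⟨⟨c, fun w v hv => hc w _ (hv.comp ρ)⟩, fun j => (hd j).rename ρ⟩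

theorem _root_.FOM.DefinableFun.digitDefinable (hf : DefinableFun f) : DigitDefinable f := by
  refine ⟨⟨6, fun w v hv => (hf.le w v hv).trans_lt (lt_base_pow_six hv.1)⟩, fun j => ?_⟩
  refine ⟨fun w v hv => ((Nat.mod_lt _ (base_pos w)).trans_le (base_le hv.1)).le, ?_⟩
  refine Definable.subst (R := fun w (v : Fin (k + 1) → ℕ) x =>
    x / base w ^ j % base w = v (Fin.last k)) ?_ (hf.rename Fin.castSucc)
  exact Definable.subst (R := fun w (v : Fin (k + 2) → ℕ) x => x = v (Fin.last k).castSucc)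
    ((IsTerm.var _).eq (.var _)) ((IsTerm.var (Fin.last (k + 1))).digit j)

theorem var (i : Fin k) : DigitDefinable (fun (_ : Str α) v => v i) :=
  DefinableFun.digitDefinable (IsTerm.definableFun (IsTerm.var _) fun _ _ hv => hv.2 i)

theorem zero : DigitDefinable (fun (_ : Str α) (_ : Fin k → ℕ) => 0) :=
  DefinableFun.digitDefinable (IsTerm.definableFun IsTerm.zero fun _ _ _ => Nat.zero_le _)

theorem one : DigitDefinable (fun (_ : Str α) (_ : Fin k → ℕ) => 1) :=
  DefinableFun.digitDefinable (IsTerm.definableFun IsTerm.one fun _ _ hv => by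
    have := hv.1; omega)

theorem last : DigitDefinable (fun (w : Str α) (_ : Fin k → ℕ) => w.1) :=
  DefinableFun.digitDefinable (IsTerm.definableFun IsTerm.last fun _ _ _ => le_rfl)

theorem base : DigitDefinable (fun (w : Str α) (_ : Fin k → ℕ) => base w) :=
  definableFun_base.digitDefinable

/-- A carry out of the lowest `j + 1` places is either generated by digit `j` alone or received from
below and passed on. The recursion on `j` unfolds into a formula of fixed size, as numbers have
boundedly many digits. -/
theorem definable_carry (hf : DigitDefinable f) (hg : DigitDefinable g) (j : ℕ) :
    Definable fun w v =>
      FOM.base w ^ j ≤ f w v % FOM.base w ^ j + g w v % FOM.base w ^ j := by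
  induction j with
  | zero => exact (Definable.const False).congr fun w v _ => by simp [Nat.mod_one]
  | succ j ih =>
    have h : Definable fun w v => (
        FOM.base w ^ j ≤ f w v % FOM.base w ^ j + g w v % FOM.base w ^ j ∧
          FOM.base w ≤ f w v / FOM.base w ^ j % FOM.base w +
            g w v / FOM.base w ^ j % FOM.base w + 1) ∨
          FOM.base w ≤ f w v / FOM.base w ^ j % FOM.base w +
            g w v / FOM.base w ^ j % FOM.base w := by
      refine Definable.subst₃ (R := fun w v x y z => (
        FOM.base w ^ j ≤ f w v % FOM.base w ^ j + g w v % FOM.base w ^ j ∧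
          z ≤ x + y + 1) ∨ z ≤ x + y) ?_ (hf.digit j) (hg.digit j) definableFun_base
      exact ((ih.rename fun i => i.castSucc.castSucc.castSucc).and
        ((IsTerm.var _).le (((IsTerm.var _).add (.var _)).succ))).or
        ((IsTerm.var _).le ((IsTerm.var _).add (.var _)))
    refine h.congr fun w v _ => ?_
    rw [pow_succ, Nat.mod_mul, Nat.mod_mul]
    have hb := base_pos w
    have hp : 0 < FOM.base w ^ j := by positivity
    generalize FOM.base w ^ j = p at *
    generalize f w v / p % FOM.base w = x
    generalize g w v / p % FOM.base w = y
    have hr := Nat.mod_lt (f w v) hp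
    have hs := Nat.mod_lt (g w v) hp
    generalize f w v % p = r at *
    generalize g w v % p = s at *
    generalize FOM.base w = b at *
    have e : r + p * x + (s + p * y) = p * (x + y) + (r + s) := by ring
    rw [e]
    constructor
    · rintro (⟨h1, h2⟩ | h)
      · nlinarith
      · nlinarith
    · intro h
      by_contra! hc
      obtain ⟨h1, h2⟩ := hc
      rcases le_or_gt p (r + s) with h3 | h3
      · have := h1 h3
        nlinarith
      · nlinarith

/-- Schoolbook addition: the new digit is the sum of both digits and the carry `c`, from which the
base is subtracted at most once. -/
theorem add (hf : DigitDefinable f) (hg : DigitDefinable g) :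
    DigitDefinable (fun w v => f w v + g w v) := by
  refine ⟨?_, fun j => ?_⟩
  · obtain ⟨c, hc⟩ := hf.lt
    obtain ⟨d, hd⟩ := hg.lt
    refine ⟨max c d + 1, fun w v hv => ?_⟩
    have h1 := (hc w v hv).trans_le (Nat.pow_le_pow_right (base_pos w) (le_max_left c d))
    have h2 := (hd w v hv).trans_le (Nat.pow_le_pow_right (base_pos w) (le_max_right c d))
    have := two_le_base hv.1
    rw [pow_succ]
    nlinarith
  · refine ⟨fun w v hv => ((Nat.mod_lt _ (base_pos w)).trans_le (base_le hv.1)).le, ?_⟩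
    have h : Definable fun w (v : Fin (k + 1) → ℕ) =>
        v (Fin.last k) < FOM.base w ∧ ∃ c ≤ w.1,
          ((c = 1 ∧ FOM.base w ^ j ≤ f w (fun i => v i.castSucc) % FOM.base w ^ j +
            g w (fun i => v i.castSucc) % FOM.base w ^ j) ∨
          (c = 0 ∧ ¬ FOM.base w ^ j ≤ f w (fun i => v i.castSucc) % FOM.base w ^ j +
            g w (fun i => v i.castSucc) % FOM.base w ^ j)) ∧
          (v (Fin.last k) = f w (fun i => v i.castSucc) / FOM.base w ^ j % FOM.base w +
            g w (fun i => v i.castSucc) / FOM.base w ^ j % FOM.base w + c ∨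
          v (Fin.last k) + FOM.base w =
            f w (fun i => v i.castSucc) / FOM.base w ^ j % FOM.base w +
            g w (fun i => v i.castSucc) / FOM.base w ^ j % FOM.base w + c) := by
      refine Definable.subst₃ (R := fun w (v : Fin (k + 1) → ℕ) x y b =>
        v (Fin.last k) < b ∧ ∃ c ≤ w.1,
          ((c = 1 ∧ FOM.base w ^ j ≤ f w (fun i => v i.castSucc) % FOM.base w ^ j +
            g w (fun i => v i.castSucc) % FOM.base w ^ j) ∨
          (c = 0 ∧ ¬ FOM.base w ^ j ≤ f w (fun i => v i.castSucc) % FOM.base w ^ j +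
            g w (fun i => v i.castSucc) % FOM.base w ^ j)) ∧
          (v (Fin.last k) = x + y + c ∨ v (Fin.last k) + b = x + y + c)) ?_
        ((hf.digit j).rename Fin.castSucc) ((hg.digit j).rename Fin.castSucc) definableFun_base
      refine ((IsTerm.var _).lt (.var _)).and ?_
      refine Definable.exists_le (R := fun w (v : Fin (k + 4) → ℕ) c =>
        ((c = 1 ∧ FOM.base w ^ j ≤
              f w (fun i => v i.castSucc.castSucc.castSucc.castSucc) % FOM.base w ^ j +
            g w (fun i => v i.castSucc.castSucc.castSucc.castSucc) % FOM.base w ^ j) ∨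
          (c = 0 ∧ ¬ FOM.base w ^ j ≤
              f w (fun i => v i.castSucc.castSucc.castSucc.castSucc) % FOM.base w ^ j +
            g w (fun i => v i.castSucc.castSucc.castSucc.castSucc) % FOM.base w ^ j)) ∧
          (v (Fin.last k).castSucc.castSucc.castSucc =
            v (Fin.last (k + 1)).castSucc.castSucc + v (Fin.last (k + 2)).castSucc + c ∨
            v (Fin.last k).castSucc.castSucc.castSucc + v (Fin.last (k + 3)) =
            v (Fin.last (k + 1)).castSucc.castSucc + v (Fin.last (k + 2)).castSucc + c)) ?_
      have hc := (definable_carry hf hg j).rename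
        fun i => i.castSucc.castSucc.castSucc.castSucc.castSucc
      exact ((((IsTerm.var _).eq .one).and hc).or (((IsTerm.var _).eq .zero).and hc.not)).and
        (((IsTerm.var _).eq (((IsTerm.var _).add (.var _)).add (.var _))).or
          (((IsTerm.var _).add (.var _)).eq (((IsTerm.var _).add (.var _)).add (.var _))))
    refine h.congr fun w v hv => ?_
    have hp : 0 < FOM.base w ^ j := by have := base_pos w; positivity
    rw [Nat.add_div hp]
    have hb := base_pos w
    have hw := hv.1
    have hx := Nat.mod_lt (f w (fun i => v i.castSucc) / FOM.base w ^ j) hb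
    have hy := Nat.mod_lt (g w (fun i => v i.castSucc) / FOM.base w ^ j) hb
    rw [Nat.add_mod, Nat.add_mod (f w (fun i => v i.castSucc) / FOM.base w ^ j)]
    generalize f w (fun i => v i.castSucc) / FOM.base w ^ j % FOM.base w = x at *
    generalize g w (fun i => v i.castSucc) / FOM.base w ^ j % FOM.base w = y at *
    rw [Nat.mod_add_mod]
    have hbase := base_le hw
    have h2 := two_le_base hw
    generalize FOM.base w = b at *
    split_ifs with hc
    · rw [Nat.mod_eq_of_lt (show 1 < b by omega)]
      simp only [hc, not_true_eq_false, and_true, and_false, or_false]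
      constructor
      · rintro ⟨h3, c, -, rfl, h4 | h4⟩
        · rw [← h4, Nat.mod_eq_of_lt h3]
        · rw [← h4, Nat.add_mod_right, Nat.mod_eq_of_lt h3]
      · intro h
        refine ⟨h ▸ Nat.mod_lt _ hb, 1, by omega, rfl, ?_⟩
        rcases lt_or_ge (x + y + 1) b with h5 | h5
        · rw [Nat.mod_eq_of_lt h5] at h
          omega
        · rw [Nat.mod_eq_sub_mod h5, Nat.mod_eq_of_lt (by omega)] at h
          omega
    · simp only [hc, not_false_eq_true, and_true, and_false, false_or, Nat.zero_mod]
      constructor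
      · rintro ⟨h3, c, -, rfl, h4 | h4⟩
        · rw [← h4, Nat.mod_eq_of_lt h3]
        · rw [← h4, Nat.add_mod_right, Nat.mod_eq_of_lt h3]
      · intro h
        refine ⟨h ▸ Nat.mod_lt _ hb, 0, by omega, rfl, ?_⟩
        rcases lt_or_ge (x + y + 0) b with h5 | h5
        · rw [Nat.mod_eq_of_lt h5] at h
          omega
        · rw [Nat.mod_eq_sub_mod h5, Nat.mod_eq_of_lt (by omega)] at h
          omega

/-- Lexicographic comparison from the most significant digit; a common bound on the number of digits
removes the truncation. -/
theorem definable_le (hf : DigitDefinable f) (hg : DigitDefinable g) :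
    Definable fun w v => f w v ≤ g w v := by
  have h : ∀ j, Definable fun w v => f w v % FOM.base w ^ j ≤ g w v % FOM.base w ^ j := by
    intro j
    induction j with
    | zero => exact (Definable.const True).congr fun w v _ => by simp [Nat.mod_one]
    | succ j ih =>
      have h : Definable fun w v =>
          f w v / FOM.base w ^ j % FOM.base w < g w v / FOM.base w ^ j % FOM.base w ∨
          (f w v / FOM.base w ^ j % FOM.base w = g w v / FOM.base w ^ j % FOM.base w ∧
            f w v % FOM.base w ^ j ≤ g w v % FOM.base w ^ j) := by
        refine Definable.subst₂ (R := fun w v x y => x < y ∨ (x = y ∧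
            f w v % FOM.base w ^ j ≤ g w v % FOM.base w ^ j)) ?_ (hf.digit j) (hg.digit j)
        exact ((IsTerm.var _).lt (.var _)).or (((IsTerm.var _).eq (.var _)).and
          (ih.rename fun i => i.castSucc.castSucc))
      refine h.congr fun w v _ => ?_
      rw [pow_succ, Nat.mod_mul, Nat.mod_mul]
      have hp : 0 < FOM.base w ^ j := by have := base_pos w; positivity
      generalize FOM.base w ^ j = p at *
      generalize f w v / p % FOM.base w = x
      generalize g w v / p % FOM.base w = y
      have hr := Nat.mod_lt (f w v) hp
      have hs := Nat.mod_lt (g w v) hp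
      generalize f w v % p = r at *
      generalize g w v % p = s at *
      rcases lt_trichotomy x y with hxy | rfl | hxy
      · simp only [hxy, true_or, true_iff]
        nlinarith
      · simp
      · simp only [hxy.not_gt, hxy.ne', false_and, or_false, false_iff, not_le]
        nlinarith
  obtain ⟨c, hc⟩ := hf.lt
  obtain ⟨d, hd⟩ := hg.lt
  refine (h (max c d)).congr fun w v hv => ?_
  rw [Nat.mod_eq_of_lt ((hc w v hv).trans_le (Nat.pow_le_pow_right (base_pos w) (le_max_left c d))),
    Nat.mod_eq_of_lt ((hd w v hv).trans_le (Nat.pow_le_pow_right (base_pos w) (le_max_right c d)))]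

theorem ite {R : Str α → (Fin k → ℕ) → Prop} [∀ w v, Decidable (R w v)] (hR : Definable R)
    (hf : DigitDefinable f) (hg : DigitDefinable g) :
    DigitDefinable (fun w v => if R w v then f w v else g w v) := by
  refine ⟨?_, fun j => ?_⟩
  · obtain ⟨c, hc⟩ := hf.lt
    obtain ⟨d, hd⟩ := hg.lt
    refine ⟨max c d, fun w v hv => ?_⟩
    split_ifs
    · exact (hc w v hv).trans_le (Nat.pow_le_pow_right (base_pos w) (le_max_left c d))
    · exact (hd w v hv).trans_le (Nat.pow_le_pow_right (base_pos w) (le_max_right c d))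
  · refine ⟨fun w v hv => ((Nat.mod_lt _ (base_pos w)).trans_le (base_le hv.1)).le, ?_⟩
    refine (((hR.rename Fin.castSucc).and (hf.digit j).graph).or
      ((hR.rename Fin.castSucc).not.and (hg.digit j).graph)).congr fun w v _ => ?_
    by_cases h : R w fun i => v i.castSucc <;> simp [h]

theorem mul_base_pow (hf : DigitDefinable f) (i : ℕ) :
    DigitDefinable (fun w v => FOM.base w ^ i * f w v) := by
  refine ⟨?_, fun j => ?_⟩
  · obtain ⟨c, hc⟩ := hf.lt
    refine ⟨i + c, fun w v hv => ?_⟩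
    rw [pow_add]
    exact Nat.mul_lt_mul_of_pos_left (hc w v hv) (by have := base_pos w; positivity)
  · rcases lt_or_ge j i with h | h
    · refine (IsTerm.definableFun IsTerm.zero fun _ _ _ => Nat.zero_le _).congr fun w v _ => ?_
      obtain ⟨i, rfl⟩ := Nat.exists_eq_add_of_lt h
      rw [show j + i + 1 = j + (i + 1) by ring, pow_add, mul_assoc,
        Nat.mul_div_cancel_left _ (by have := base_pos w; positivity), pow_succ',
        mul_assoc, Nat.mul_mod_right]
    · refine (hf.digit (j - i)).congr fun w v _ => ?_
      obtain ⟨j, rfl⟩ := Nat.exists_eq_add_of_le h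
      rw [Nat.add_sub_cancel_left, pow_add, Nat.mul_div_mul_left _ _
        (by have := base_pos w; positivity)]

theorem sum_range {F : ℕ → Str α → (Fin k → ℕ) → ℕ} (hF : ∀ j, DigitDefinable (F j)) (c : ℕ) :
    DigitDefinable (fun w v => ∑ j ∈ Finset.range c, F j w v) := by
  induction c with
  | zero => exact zero.congr fun w v _ => by simp
  | succ c ih => exact (ih.add (hF c)).congr fun w v _ => by rw [Finset.sum_range_succ]

theorem sum_digits (b x c : ℕ) : ∑ j ∈ Finset.range c, b ^ j * (x / b ^ j % b) = x % b ^ c := by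
  induction c with
  | zero => simp [Nat.mod_one]
  | succ c ih => rw [Finset.sum_range_succ, ih, pow_succ, Nat.mod_mul]

/-- The sum counts the pairs (y, z) with z < d y, and a pair is coded by `b * y + z`, which lies
below `b ^ 2`. -/
theorem sum_eq_card_pairs (b h : ℕ) (hh : b ^ 2 ≤ h) (d : ℕ → ℕ) (hd : ∀ y, d y < b) :
    ∑ y ∈ Finset.range b, d y =
      ((Finset.range h).filter fun q => q < b ^ 2 ∧ q % b < d (q / b)).card := by
  have hb : 0 < b := (Nat.zero_le _).trans_lt (hd 0)
  rw [Finset.sum_congr rfl fun y _ => (Finset.card_range (d y)).symm, ← Finset.card_sigma]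
  refine Finset.card_bij (fun p _ => b * p.1 + p.2) ?_ ?_ ?_
  · rintro ⟨y, z⟩ hp
    simp only [Finset.mem_sigma, Finset.mem_range] at hp
    have hz := hp.2.trans (hd y)
    have : b * y + z < b ^ 2 := by nlinarith [hp.1]
    simp only [Finset.mem_filter, Finset.mem_range]
    refine ⟨this.trans_le hh, this, ?_⟩
    rw [Nat.mul_add_mod, Nat.mod_eq_of_lt hz, Nat.mul_add_div hb, Nat.div_eq_of_lt hz, add_zero]
    exact hp.2
  · rintro ⟨y, z⟩ hp ⟨y', z'⟩ hp' h
    simp only [Finset.mem_sigma, Finset.mem_range] at hp hp'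
    have hz := hp.2.trans (hd y)
    have hz' := hp'.2.trans (hd y')
    simp only at h
    have h1 : (b * y + z) / b = (b * y' + z') / b := by rw [h]
    have h2 : (b * y + z) % b = (b * y' + z') % b := by rw [h]
    rw [Nat.mul_add_div hb, Nat.div_eq_of_lt hz, Nat.mul_add_div hb, Nat.div_eq_of_lt hz'] at h1
    rw [Nat.mul_add_mod, Nat.mod_eq_of_lt hz, Nat.mul_add_mod, Nat.mod_eq_of_lt hz'] at h2
    simp at h1 h2
    rw [h1, h2]
  · intro q hq
    simp only [Finset.mem_filter, Finset.mem_range] at hq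
    refine ⟨⟨q / b, q % b⟩, ?_, Nat.div_add_mod q b⟩
    simp only [Finset.mem_sigma, Finset.mem_range]
    exact ⟨Nat.div_lt_of_lt_mul (by rw [← pow_two]; exact hq.2.1), hq.2.2⟩

/-- Summation over a digit. -/
theorem sum_base {F : Str α → (Fin k → ℕ) → ℕ → ℕ}
    (hF : DigitDefinable fun w (v : Fin (k + 1) → ℕ) =>
      F w (fun i => v i.castSucc) (v (Fin.last k))) :
    DigitDefinable fun w v => ∑ y ∈ Finset.range (FOM.base w), F w v y := by
  classical
  -- Column `j` of the addition: the sum of the digits in place `j` over all summands, expressed as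
  -- a count of pairs.
  have hC : ∀ j, DefinableFun fun w v =>
      ((Finset.range ((w.1 + 1) / 2)).filter fun q => q < FOM.base w ^ 2 ∧
        q % FOM.base w < F w v (q / FOM.base w) / FOM.base w ^ j % FOM.base w).card := by
    intro j
    refine DefinableFun.card_filter_lt (R := fun w v q => q < FOM.base w ^ 2 ∧
        q % FOM.base w < F w v (q / FOM.base w) / FOM.base w ^ j % FOM.base w) ?_
    -- The components of the pair coded by a position are its digits 0 and 1; the reduction modulo
    -- the base in digit 1 is void for codes below the square of the base.
    have h : Definable fun w (v : Fin (k + 1) → ℕ) =>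
        ¬ FOM.base w ^ 1 * FOM.base w ≤ v (Fin.last k) ∧
          v (Fin.last k) / FOM.base w ^ 0 % FOM.base w <
            F w (fun i => v i.castSucc) (v (Fin.last k) / FOM.base w ^ 1 % FOM.base w) /
              FOM.base w ^ j % FOM.base w := by
      refine (definable_le (base.mul_base_pow 1) (var _)).not.and ?_
      refine Definable.subst₂ (R := fun w (v : Fin (k + 1) → ℕ) x y =>
        x < F w (fun i => v i.castSucc) y / FOM.base w ^ j % FOM.base w) ?_
        ((IsTerm.var _).digit 0) ((IsTerm.var _).digit 1)
      refine Definable.subst (R := fun w (v : Fin (k + 3) → ℕ) z =>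
        v (Fin.last (k + 1)).castSucc < z) ((IsTerm.var _).lt (.var _)) ?_
      refine ((hF.digit j).rename (Fin.snoc (α := fun _ => Fin (k + 3))
        (fun i => i.castSucc.castSucc.castSucc) (Fin.last (k + 2)))).congr fun w v _ => ?_
      simp
    refine h.congr fun w v _ => ?_
    rw [pow_one, pow_zero, Nat.div_one, not_le, pow_two]
    refine and_congr_right fun hq => ?_
    rw [Nat.mod_eq_of_lt (Nat.div_lt_of_lt_mul hq)]
  obtain ⟨c, hc⟩ := hF.lt
  refine (sum_range (fun j => (hC j).digitDefinable.mul_base_pow j) c).congr fun w v hv => ?_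
  have h1 := two_mul_base_sq_le hv.1
  have h2 : ∀ y ∈ Finset.range (FOM.base w),
      F w v y = ∑ j ∈ Finset.range c, FOM.base w ^ j *
        (F w v y / FOM.base w ^ j % FOM.base w) := by
    intro y hy
    rw [Finset.mem_range] at hy
    have := hc w (Fin.snoc (α := fun _ => ℕ) v y) (hv.snoc (by have := base_le hv.1; omega))
    simp only [Fin.snoc_castSucc, Fin.snoc_last] at this
    rw [sum_digits, Nat.mod_eq_of_lt this]
  -- Each summand is expanded into its `c` digits, and the two sums are exchanged to sum by columns.
  rw [Finset.sum_congr rfl h2, Finset.sum_comm]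
  refine Finset.sum_congr rfl fun j _ => ?_
  rw [← Finset.mul_sum, sum_eq_card_pairs (FOM.base w) ((w.1 + 1) / 2) (by omega) _
    fun y => Nat.mod_lt _ (base_pos w)]

end DigitDefinable

end FOM

namespace FOM

variable {α : Type u}

/-! ## Feasible functions -/

/-- A type of environments, each of which comprises a string. The admissible substitutions are
the families of environments that are given by digit definable functions. -/
class Context (α : outParam (Type u)) (E : Type u) where
  str : E → Str α
  Adm : ∀ {k : ℕ}, (Str α → (Fin k → ℕ) → E) → Prop
  str_eq : ∀ {k : ℕ} {γ : Str α → (Fin k → ℕ) → E}, Adm γ → ∀ w v, str (γ w v) = w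
  rename : ∀ {k m : ℕ} {γ : Str α → (Fin k → ℕ) → E}, Adm γ → ∀ ρ : Fin k → Fin m,
    Adm fun w v => γ w fun i => v (ρ i)

open Context

instance : Context α (Str α) where
  str w := w
  Adm γ := ∀ w v, γ w v = w
  str_eq h := h
  rename h _ _ _ := h _ _

instance {E : Type u} [Context α E] : Context α (E × ℕ) where
  str p := str p.1
  Adm γ := Adm (fun w v => (γ w v).1) ∧ DigitDefinable fun w v => (γ w v).2
  str_eq h := str_eq h.1
  rename h ρ := ⟨rename h.1 ρ, h.2.rename ρ⟩

instance {E : Type u} [Context α E] : Context α ((e : E) × Fin ((str e).1 + 1)) where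
  str p := str p.1
  Adm γ := Adm (fun w v => (γ w v).1) ∧ DigitDefinable fun w v => ((γ w v).2 : ℕ)
  str_eq h := str_eq h.1
  rename h ρ := ⟨rename h.1 ρ, h.2.rename ρ⟩

variable {E E' : Type u} [Context α E] [Context α E']

/-- A function of environments that turns digit definable arguments into digit definable
values. -/
structure Feasible (f : E → ℕ) : Prop where
  subst : ∀ {k : ℕ} {γ : Str α → (Fin k → ℕ) → E}, Adm γ → DigitDefinable fun w v => f (γ w v)

/-- A relation that is definable for digit definable arguments. -/
structure FeasibleRel (R : E → Prop) : Prop where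
  subst : ∀ {k : ℕ} {γ : Str α → (Fin k → ℕ) → E}, Adm γ → Definable fun w v => R (γ w v)

/-- A map between environments that keeps the string and preserves admissible substitutions. -/
structure FeasibleMap (g : E → E') : Prop where
  adm : ∀ {k : ℕ} {γ : Str α → (Fin k → ℕ) → E}, Adm γ → Adm fun w v => g (γ w v)
  str_eq : ∀ e, str (g e) = str e

theorem FeasibleMap.id : FeasibleMap (fun e : E => e) := ⟨fun h => h, fun _ => rfl⟩

theorem FeasibleMap.comp {E'' : Type u} [Context α E''] {g : E' → E''} {h : E → E'}
    (hg : FeasibleMap g) (hh : FeasibleMap h) : FeasibleMap fun e => g (h e) :=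
  ⟨fun hγ => hg.adm (hh.adm hγ), fun e => (hg.str_eq _).trans (hh.str_eq e)⟩

theorem FeasibleMap.fst : FeasibleMap (Prod.fst : E × ℕ → E) := ⟨fun h => h.1, fun _ => rfl⟩

theorem FeasibleMap.pair {g : E → E'} {f : E → ℕ} (hg : FeasibleMap g) (hf : Feasible f) :
    FeasibleMap fun e => (g e, f e) := ⟨fun h => ⟨hg.adm h, hf.subst h⟩, hg.str_eq⟩

theorem FeasibleMap.sigma {g : E → E'} {f : ∀ e, Fin ((str (g e)).1 + 1)} (hg : FeasibleMap g)
    (hf : Feasible fun e => (f e : ℕ)) :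
    FeasibleMap fun e => (⟨g e, f e⟩ : (e : E') × Fin ((str e).1 + 1)) :=
  ⟨fun h => ⟨hg.adm h, hf.subst h⟩, hg.str_eq⟩

theorem FeasibleMap.sigma_fst : FeasibleMap (Sigma.fst : ((e : E) × Fin ((str e).1 + 1)) → E) :=
  ⟨fun h => h.1, fun _ => rfl⟩

/-- A number below b ^ (c + 1) is b ^ c * z + y with a digit z and y < b ^ c, so one summation over
a digit is added at each step. The summation index need not be a position; therefore `G` is assumed
to preserve digit definability for arbitrary digit definable arguments. -/
theorem DigitDefinable.sum_base_pow (c : ℕ) : ∀ {k : ℕ} (G : Str α → (Fin k → ℕ) → ℕ → ℕ),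
    (∀ (m : ℕ) (ρ : Fin k → Fin m) (Y : Str α → (Fin m → ℕ) → ℕ), DigitDefinable Y →
      DigitDefinable fun w v => G w (fun i => v (ρ i)) (Y w v)) →
    DigitDefinable fun w v => ∑ y ∈ Finset.range (FOM.base w ^ c), G w v y := by
  induction c with
  | zero =>
    intro k G hG
    exact (hG k id _ .zero).congr fun w v _ => by simp
  | succ c ih =>
    intro k G hG
    have h1 : DigitDefinable fun w (v : Fin (k + 1) → ℕ) =>
        ∑ y ∈ Finset.range (FOM.base w ^ c),
          G w (fun i => v i.castSucc) (FOM.base w ^ c * v (Fin.last k) + y) := by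
      refine ih (fun w (v : Fin (k + 1) → ℕ) y =>
        G w (fun i => v i.castSucc) (FOM.base w ^ c * v (Fin.last k) + y)) fun m ρ Y hY => ?_
      exact hG m (fun i => ρ i.castSucc) _ (((DigitDefinable.var _).mul_base_pow c).add hY)
    refine (DigitDefinable.sum_base (F := fun w v z => ∑ y ∈ Finset.range (FOM.base w ^ c),
      G w v (FOM.base w ^ c * z + y)) h1).congr fun w v _ => ?_
    rw [pow_succ]
    generalize FOM.base w ^ c = p
    generalize FOM.base w = b
    induction b with
    | zero => simp
    | succ b ih => rw [Finset.sum_range_succ, ih, Nat.mul_succ, Finset.sum_range_add]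

/-! ### Bounded summation and the arithmetic that it generates -/

namespace Feasible

variable {f g : E → ℕ}

theorem comp {f : E' → ℕ} (hf : Feasible f) {g : E → E'} (hg : FeasibleMap g) :
    Feasible fun e => f (g e) := ⟨fun h => hf.subst (hg.adm h)⟩

theorem fst (hf : Feasible f) : Feasible fun p : E × ℕ => f p.1 := hf.comp FeasibleMap.fst

theorem snd : Feasible fun p : E × ℕ => p.2 := ⟨fun h => h.2⟩

theorem const (c : ℕ) : Feasible fun _ : E => c := by
  induction c with
  | zero => exact ⟨fun _ => .zero⟩
  | succ c ih => exact ⟨fun h => (ih.subst h).add .one⟩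

theorem last : Feasible fun e : E => (str e).1 :=
  ⟨fun h => DigitDefinable.last.congr fun w v _ => by simp only [str_eq h]⟩

theorem add (hf : Feasible f) (hg : Feasible g) : Feasible fun e => f e + g e :=
  ⟨fun h => (hf.subst h).add (hg.subst h)⟩

theorem le (hf : Feasible f) (hg : Feasible g) : FeasibleRel fun e => f e ≤ g e :=
  ⟨fun h => (hf.subst h).definable_le (hg.subst h)⟩

theorem lt (hf : Feasible f) (hg : Feasible g) : FeasibleRel fun e => f e < g e :=
  ⟨fun h => ((hg.le hf).subst h).not.congr fun _ _ _ => not_le⟩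

theorem eq (hf : Feasible f) (hg : Feasible g) : FeasibleRel fun e => f e = g e :=
  ⟨fun h => (((hf.le hg).subst h).and ((hg.le hf).subst h)).congr
    fun _ _ _ => le_antisymm_iff.symm⟩

theorem ite {R : E → Prop} [DecidablePred R] (hR : FeasibleRel R) (hf : Feasible f)
    (hg : Feasible g) : Feasible fun e => if R e then f e else g e :=
  ⟨fun h => DigitDefinable.ite (hR.subst h) (hf.subst h) (hg.subst h)⟩

/-- After an admissible substitution `t` is below a fixed power of the base. The sum is extended to
that power, with the terms from `t` on replaced by zero. -/
theorem sum_range {F : E → ℕ → ℕ} {t : E → ℕ} (ht : Feasible t)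
    (hF : Feasible fun p : E × ℕ => F p.1 p.2) :
    Feasible fun e => ∑ y ∈ Finset.range (t e), F e y := by
  refine ⟨fun {k γ} h => ?_⟩
  obtain ⟨c, hc⟩ := (ht.subst h).lt
  refine (DigitDefinable.sum_base_pow c
    (fun w v y => if y < t (γ w v) then F (γ w v) y else 0) fun m ρ Y hY => ?_).congr
    fun w v hv => ?_
  · have hγ := rename h ρ
    have h1 : Adm fun w v => (γ w fun i => v (ρ i), Y w v) := ⟨hγ, hY⟩
    exact DigitDefinable.ite ((snd.lt ht.fst).subst h1) (hF.subst h1) .zero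
  · rw [← Finset.sum_filter]
    refine Finset.sum_congr ?_ fun _ _ => rfl
    ext y
    have := hc w v hv
    simp only [Finset.mem_filter, Finset.mem_range]
    omega

theorem mul (hf : Feasible f) (hg : Feasible g) : Feasible fun e => f e * g e := by
  simpa using hf.sum_range (F := fun e _ => g e) hg.fst

theorem sub (hf : Feasible f) (hg : Feasible g) : Feasible fun e => f e - g e := by
  have h := hf.sum_range (F := fun e y => if g e ≤ y then 1 else 0)
    (ite (hg.fst.le snd) (const 1) (const 0))
  refine ⟨fun {k γ} hγ => (h.subst hγ).congr fun w v _ => ?_⟩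
  rw [Finset.sum_boole]
  have : (Finset.range (f (γ w v))).filter (fun y => g (γ w v) ≤ y) =
      Finset.Ico (g (γ w v)) (f (γ w v)) := by
    ext y
    simp only [Finset.mem_filter, Finset.mem_range, Finset.mem_Ico]
    omega
  rw [this, Nat.card_Ico, Nat.cast_id]

theorem pow (hf : Feasible f) (c : ℕ) : Feasible fun e => f e ^ c := by
  induction c with
  | zero => simpa using const 1
  | succ c ih => simpa only [pow_succ] using ih.mul hf

end Feasible

namespace FeasibleRel

variable {R S : E → Prop}

theorem comp {R : E' → Prop} (hR : FeasibleRel R) {g : E → E'} (hg : FeasibleMap g) :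
    FeasibleRel fun e => R (g e) := ⟨fun h => hR.subst (hg.adm h)⟩

theorem congr (hR : FeasibleRel R) (h : ∀ e, R e ↔ S e) : FeasibleRel S :=
  ⟨fun hγ => (hR.subst hγ).congr fun _ _ _ => h _⟩

theorem not (hR : FeasibleRel R) : FeasibleRel fun e => ¬ R e := ⟨fun h => (hR.subst h).not⟩

theorem and (hR : FeasibleRel R) (hS : FeasibleRel S) : FeasibleRel fun e => R e ∧ S e :=
  ⟨fun h => (hR.subst h).and (hS.subst h)⟩

theorem or (hR : FeasibleRel R) (hS : FeasibleRel S) : FeasibleRel fun e => R e ∨ S e :=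
  ⟨fun h => (hR.subst h).or (hS.subst h)⟩

theorem imp (hR : FeasibleRel R) (hS : FeasibleRel S) : FeasibleRel fun e => R e → S e :=
  ⟨fun h => (hR.subst h).imp (hS.subst h)⟩

theorem const (P : Prop) : FeasibleRel fun _ : E => P := ⟨fun _ => .const P⟩

/-- A witness exists iff the number of witnesses is positive, and this number is a bounded sum. So
quantifiers may range over numbers beyond the positions. -/
theorem exists_lt {R : E → ℕ → Prop} {t : E → ℕ} (ht : Feasible t)
    (hR : FeasibleRel fun p : E × ℕ => R p.1 p.2) : FeasibleRel fun e => ∃ y < t e, R e y := by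
  classical
  refine ((Feasible.const 0).lt (ht.sum_range (F := fun e y => if R e y then 1 else 0)
    (Feasible.ite hR (.const 1) (.const 0)))).congr fun e => ?_
  rw [Finset.sum_boole, Nat.cast_id, Finset.card_pos]
  simp [Finset.Nonempty]

theorem forall_lt {R : E → ℕ → Prop} {t : E → ℕ} (ht : Feasible t)
    (hR : FeasibleRel fun p : E × ℕ => R p.1 p.2) : FeasibleRel fun e => ∀ y < t e, R e y :=
  (exists_lt ht (R := fun e y => ¬ R e y) hR.not).not.congr fun _ => by push Not; rfl

theorem token {t : E → ℕ} (ht : Feasible t) (a : α) :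
    FeasibleRel fun e => ∃ p : Fin ((str e).1 + 1), t e = p ∧ (str e).2 p = a := by
  refine ⟨fun {k γ} h => ?_⟩
  have h1 : Definable fun w v => ∃ x ≤ w.1, x = t (γ w v) ∧
      ∃ p : Fin (w.1 + 1), x = p ∧ w.2 p = a := by
    refine Definable.exists_le (R := fun w v x => x = t (γ w v) ∧
      ∃ p : Fin (w.1 + 1), x = p ∧ w.2 p = a) ?_
    have hle := (DigitDefinable.var (Fin.last k)).definable_le ((ht.subst h).rename Fin.castSucc)
    have hge := ((ht.subst h).rename Fin.castSucc).definable_le (DigitDefinable.var (Fin.last k))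
    exact ((hle.and hge).congr fun _ _ _ => le_antisymm_iff.symm).and ((IsTerm.var _).token a)
  refine h1.congr fun w v _ => ?_
  have hw := str_eq h w v
  generalize str (γ w v) = w' at *
  subst hw
  constructor
  · rintro ⟨x, -, rfl, p, h2⟩
    exact ⟨p, h2⟩
  · rintro ⟨p, h2⟩
    exact ⟨_, by omega, rfl, p, h2⟩

end FeasibleRel

namespace Feasible

variable {f g : E → ℕ}

/-- The value is the sum of all y ≤ B that satisfy the graph relation, and there is only one such y.
-/
theorem of_graph {B : E → ℕ} (hB : Feasible B) (hle : ∀ e, f e ≤ B e)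
    (h : FeasibleRel fun p : E × ℕ => f p.1 = p.2) : Feasible f := by
  classical
  have h1 := (hB.add (const 1)).sum_range (F := fun e y => if f e = y then y else 0)
    (ite h snd (const 0))
  refine ⟨fun {k γ} hγ => (h1.subst hγ).congr fun w v _ => ?_⟩
  rw [Finset.sum_ite_eq, if_pos]
  have := hle (γ w v)
  simp only [Finset.mem_range]
  omega

theorem findGreatest {R : E → ℕ → Prop} [∀ e, DecidablePred (R e)] {t : E → ℕ} (ht : Feasible t)
    (hR : FeasibleRel fun p : E × ℕ => R p.1 p.2) :
    Feasible fun e => Nat.findGreatest (R e) (t e) := by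
  refine of_graph ht (fun e => Nat.findGreatest_le _) ?_
  have h : FeasibleRel fun p : E × ℕ => p.2 ≤ t p.1 ∧ (¬ p.2 = 0 → R p.1 p.2) ∧
      ∀ y < t p.1 + 1, p.2 < y → ¬ R p.1 y := by
    refine (snd.le ht.fst).and (((snd.eq (const 0)).not.imp hR).and ?_)
    refine FeasibleRel.forall_lt (R := fun (p : E × ℕ) y => p.2 < y → ¬ R p.1 y)
      (ht.fst.add (const 1)) ((snd.fst.lt snd).imp ?_)
    exact (FeasibleRel.comp hR ((FeasibleMap.fst.comp FeasibleMap.fst).pair snd)).not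
  refine h.congr fun p => ?_
  rw [Nat.findGreatest_eq_iff]
  simp only [Nat.lt_succ_iff]
  exact and_congr_right' (and_congr_right' ⟨fun h y h1 h2 => h y h2 h1, fun h y h1 h2 => h h2 h1⟩)

end Feasible

/-- Feasible functions are closed under every generating operation. The context must vary in the
induction, since a bounded sum adds its index to the environment. -/
theorem _root_.LowerElementary.feasible {k : ℕ} {f : (Fin k → ℕ) → ℕ} (hf : LowerElementary f) :
    ∀ {E : Type u} [Context α E] {t : Fin k → E → ℕ}, (∀ i, Feasible (t i)) →
      Feasible fun e => f fun i => t i e := by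
  induction hf with
  | const c => exact fun _ => .const c
  | proj i => exact fun h => h i
  | add _ _ ihf ihg => exact fun h => (ihf h).add (ihg h)
  | sub _ _ ihf ihg => exact fun h => (ihf h).sub (ihg h)
  | comp _ _ ihf ihg => exact fun h => ihf fun i => ihg i h
  | @bsum k f _ ih =>
    intro E _ t h
    refine ((h (Fin.last k)).add (.const 1)).sum_range (F := fun e y =>
      f (Fin.snoc (α := fun _ => ℕ) (Fin.init fun i => t i e) y)) ?_
    have := ih (E := E × ℕ) (t := Fin.snoc (α := fun _ => E × ℕ → ℕ)
      (fun i p => t i.castSucc p.1) fun p => p.2) ?_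
    · convert this using 4 with p i
      rename_i i
      refine Fin.lastCases ?_ (fun i => ?_) i <;> simp [Fin.init]
    · intro i
      refine Fin.lastCases ?_ (fun i => ?_) i
      · simpa using Feasible.snd
      · simpa using (h i.castSucc).fst

/-- Powers of two are the positive numbers without an odd divisor `2 * d + 3`. This trades the
exponent for bounded quantifiers and multiplication. -/
theorem isPowerOfTwo_iff (y : ℕ) : (∃ i, y = 2 ^ i) ↔
    0 < y ∧ ¬ ∃ d < y + 1, ∃ e < y + 1, y = (2 * d + 3) * e := by
  constructor
  · rintro ⟨i, rfl⟩
    refine ⟨by positivity, ?_⟩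
    rintro ⟨d, -, e, -, h⟩
    obtain ⟨j, -, hj⟩ := (Nat.dvd_prime_pow Nat.prime_two).1 (Dvd.intro _ h.symm)
    cases j with
    | zero => omega
    | succ j => rw [pow_succ] at hj; omega
  · rintro ⟨h0, h⟩
    refine (Nat.eq_two_pow_or_exists_odd_prime_and_dvd y).resolve_right ?_
    rintro ⟨p, hp, ⟨e, rfl⟩, j, rfl⟩
    have h2 := hp.two_le
    have he : 0 < e := by
      rcases Nat.eq_zero_or_pos e with rfl | he
      · simp at h0
      · exact he
    refine h ⟨j - 1, ?_, e, ?_, ?_⟩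
    · nlinarith [Nat.sub_le j 1]
    · nlinarith
    · rw [show 2 * (j - 1) + 3 = 2 * j + 1 by omega]

theorem FeasibleRel.isPowerOfTwo {f : E → ℕ} (hf : Feasible f) :
    FeasibleRel fun e => ∃ i, f e = 2 ^ i := by
  refine FeasibleRel.congr ?_ fun e => (isPowerOfTwo_iff (f e)).symm
  refine ((Feasible.const 0).lt hf).and (FeasibleRel.not ?_)
  refine FeasibleRel.exists_lt (hf.add (.const 1)) (R := fun e d =>
    ∃ y < f e + 1, f e = (2 * d + 3) * y) ?_
  refine FeasibleRel.exists_lt (hf.fst.add (.const 1)) (R := fun (p : E × ℕ) y =>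
    f p.1 = (2 * p.2 + 3) * y) ?_
  exact hf.fst.fst.eq ((((Feasible.const 2).mul Feasible.snd.fst).add (.const 3)).mul .snd)

/-- Here the logarithmic precision enters. For a length n, `2 ^ Nat.size n` is the only power of two
above n and at most 2n, and a fixed power `c` of it is still polynomial. -/
theorem Feasible.two_pow_mul_size (c : ℕ) :
    Feasible fun e : E => 2 ^ (c * Nat.size ((str e).1 + 1)) := by
  have h : Feasible fun e : E => 2 ^ Nat.size ((str e).1 + 1) := by
    have hlt : ∀ n, n + 1 < 2 ^ Nat.size (n + 1) := fun n => Nat.lt_size_self _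
    have hle : ∀ n, 2 ^ Nat.size (n + 1) ≤ 2 * (n + 1) := by
      intro n
      have h0 : 0 < Nat.size (n + 1) := Nat.size_pos.2 (by omega)
      have := Nat.lt_size.1 (Nat.sub_lt h0 one_pos)
      calc 2 ^ Nat.size (n + 1) = 2 * 2 ^ (Nat.size (n + 1) - 1) := by
            rw [← pow_succ', Nat.sub_add_cancel h0]
        _ ≤ _ := by omega
    refine Feasible.of_graph (B := fun e => 2 * ((str e).1 + 1))
      ((Feasible.const 2).mul (Feasible.last.add (.const 1))) (fun e => hle _) ?_
    refine FeasibleRel.congr (((FeasibleRel.isPowerOfTwo Feasible.snd).and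
      ((Feasible.last.fst.add (.const 1)).lt .snd)).and
      (Feasible.snd.le ((Feasible.const 2).mul (Feasible.last.fst.add (.const 1))))) ?_
    rintro ⟨e, y⟩
    constructor
    · rintro ⟨⟨⟨i, hi⟩, h1⟩, h2⟩
      simp only at hi h1 h2 ⊢
      subst hi
      have h3 := hlt (str e).1
      have h4 := hle (str e).1
      have a1 : Nat.size ((str e).1 + 1) < i + 1 :=
        (Nat.pow_lt_pow_iff_right (a := 2) (by norm_num)).1 (by rw [pow_succ]; omega)
      have a2 : i < Nat.size ((str e).1 + 1) + 1 :=
        (Nat.pow_lt_pow_iff_right (a := 2) (by norm_num)).1 (by rw [pow_succ]; omega)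
      rw [show i = Nat.size ((str e).1 + 1) by omega]
    · intro h
      simp only at h ⊢
      rw [← h]
      exact ⟨⟨⟨_, rfl⟩, hlt _⟩, hle _⟩
  simpa only [mul_comm c, pow_mul] using h.pow c

end FOM

namespace FOM

open Context

variable {α : Type u} {E E' : Type u} [Context α E] [Context α E']

/-! ## Functions of the positions of a string -/

theorem Feasible.sigma_snd : Feasible fun p : (e : E) × Fin ((str e).1 + 1) => (p.2 : ℕ) :=
  ⟨fun h => h.2⟩

/-- Numbers beyond the last position of the string are replaced by the last position. -/
def clamp (p : E × ℕ) : (e : E) × Fin ((str e).1 + 1) :=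
  ⟨p.1, ⟨min p.2 (str p.1).1, Nat.lt_succ_of_le (min_le_right _ _)⟩⟩

theorem feasibleMap_clamp : FeasibleMap (clamp : E × ℕ → _) := by
  refine FeasibleMap.fst.sigma ?_
  simp only [min_def]
  exact Feasible.ite (Feasible.snd.le Feasible.last.fst) .snd Feasible.last.fst

theorem clamp_val (e : E) (j : Fin ((str e).1 + 1)) : clamp (e, (j : ℕ)) = ⟨e, j⟩ := by
  have : min (j : ℕ) (str e).1 = j := min_eq_left (by omega)
  simp [clamp, this]

theorem Feasible.sum_fin {F : (e : E) × Fin ((str e).1 + 1) → ℕ} (hF : Feasible F)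
    {R : ∀ e : E, Fin ((str e).1 + 1) → Prop} [∀ e, DecidablePred (R e)]
    (hR : FeasibleRel fun p : (e : E) × Fin ((str e).1 + 1) => R p.1 p.2) :
    Feasible fun e => ∑ j ∈ Finset.univ.filter (R e), F ⟨e, j⟩ := by
  have h := Feasible.sum_range (t := fun e : E => (str e).1 + 1)
    (F := fun e y => if R (clamp (e, y)).1 (clamp (e, y)).2 then F (clamp (e, y)) else 0)
    (Feasible.last.add (.const 1))
    (Feasible.ite (hR.comp feasibleMap_clamp) (hF.comp feasibleMap_clamp) (.const 0))
  convert h using 2 with e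
  rw [Finset.sum_range, Finset.sum_filter]
  refine Finset.sum_congr rfl fun j _ => ?_
  rw [clamp_val]

/-! ## Feasible real functions -/

/-- The number of bits of precision, as a function of the environment. -/
def bitsOf (c : ℕ) (e : E) : ℕ := c * Nat.size ((str e).1 + 1)

theorem Feasible.two_pow_bitsOf (c : ℕ) : Feasible fun e : E => 2 ^ bitsOf c e :=
  Feasible.two_pow_mul_size c

/-- A function whose values are feasible multiples of the unit of the given precision. -/
def FeasibleReal (c : ℕ) (f : E → ℝ) : Prop :=
  ∃ P N : E → ℕ, Feasible P ∧ Feasible N ∧ ∀ e, f e = ((P e : ℝ) - N e) / 2 ^ bitsOf c e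

/-- A function whose values are quotients of feasible integers. -/
def FeasibleRat (f : E → ℝ) : Prop :=
  ∃ P N D : E → ℕ, Feasible P ∧ Feasible N ∧ Feasible D ∧ (∀ e, 0 < D e) ∧
    ∀ e, f e = ((P e : ℝ) - N e) / D e

/-! ### Rational arithmetic before rounding -/

namespace FeasibleRat

variable {f g : E → ℝ}

theorem const (q : ℚ) : FeasibleRat fun _ : E => (q : ℝ) := by
  refine ⟨fun _ => q.num.toNat, fun _ => (-q.num).toNat, fun _ => q.den, .const _, .const _,
    .const _, fun _ => q.pos, fun _ => ?_⟩
  have h : (q.num : ℝ) = (q.num.toNat : ℝ) - ((-q.num).toNat : ℝ) := by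
    exact_mod_cast (Int.toNat_sub_toNat_neg q.num).symm
  beta_reduce
  rw [← h]
  exact_mod_cast (Rat.num_div_den q).symm

theorem natCast {f : E → ℕ} (hf : Feasible f) : FeasibleRat fun e => (f e : ℝ) :=
  ⟨f, fun _ => 0, fun _ => 1, hf, .const 0, .const 1, fun _ => one_pos, fun _ => by simp⟩

theorem neg (hf : FeasibleRat f) : FeasibleRat fun e => -f e := by
  obtain ⟨P, N, D, hP, hN, hD, h0, h⟩ := hf
  exact ⟨N, P, D, hN, hP, hD, h0, fun e => by beta_reduce; rw [h, ← neg_div, neg_sub]⟩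

theorem add (hf : FeasibleRat f) (hg : FeasibleRat g) : FeasibleRat fun e => f e + g e := by
  obtain ⟨P, N, D, hP, hN, hD, h0, h⟩ := hf
  obtain ⟨P', N', D', hP', hN', hD', h0', h'⟩ := hg
  refine ⟨fun e => P e * D' e + P' e * D e, fun e => N e * D' e + N' e * D e,
    fun e => D e * D' e, (hP.mul hD').add (hP'.mul hD), (hN.mul hD').add (hN'.mul hD),
    hD.mul hD', fun e => Nat.mul_pos (h0 e) (h0' e), fun e => ?_⟩
  have h1 : (D e : ℝ) ≠ 0 := by exact_mod_cast (h0 e).ne'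
  have h2 : (D' e : ℝ) ≠ 0 := by exact_mod_cast (h0' e).ne'
  beta_reduce
  rw [h, h']
  push_cast
  field_simp
  ring

theorem sub (hf : FeasibleRat f) (hg : FeasibleRat g) : FeasibleRat fun e => f e - g e := by
  simpa only [sub_eq_add_neg] using hf.add hg.neg

theorem mul (hf : FeasibleRat f) (hg : FeasibleRat g) : FeasibleRat fun e => f e * g e := by
  obtain ⟨P, N, D, hP, hN, hD, h0, h⟩ := hf
  obtain ⟨P', N', D', hP', hN', hD', h0', h'⟩ := hg
  refine ⟨fun e => P e * P' e + N e * N' e, fun e => P e * N' e + N e * P' e,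
    fun e => D e * D' e, (hP.mul hP').add (hN.mul hN'), (hP.mul hN').add (hN.mul hP'),
    hD.mul hD', fun e => Nat.mul_pos (h0 e) (h0' e), fun e => ?_⟩
  beta_reduce
  rw [h, h', div_mul_div_comm]
  push_cast
  ring_nf

/-- Numerator and denominator are exchanged and the sign is moved upstairs. If the value is 0, the
result is 0 / 1, in agreement with the convention for division by zero. -/
theorem inv (hf : FeasibleRat f) : FeasibleRat fun e => (f e)⁻¹ := by
  obtain ⟨P, N, D, hP, hN, hD, h0, h⟩ := hf
  refine ⟨fun e => if N e < P e then D e else 0, fun e => if P e < N e then D e else 0,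
    fun e => if P e = N e then 1 else (P e - N e) + (N e - P e),
    .ite (hN.lt hP) hD (.const 0), .ite (hP.lt hN) hD (.const 0),
    .ite (hP.eq hN) (.const 1) ((hP.sub hN).add (hN.sub hP)), fun e => ?_, fun e => ?_⟩
  · beta_reduce
    split_ifs <;> omega
  · beta_reduce
    rw [h, inv_div]
    rcases lt_trichotomy (P e) (N e) with h1 | h1 | h1
    · have h2 : (P e : ℝ) < N e := by exact_mod_cast h1
      simp only [h1, h1.not_gt, h1.ne, if_false, if_true, Nat.sub_eq_zero_of_le h1.le, zero_add,
        Nat.cast_sub h1.le, Nat.cast_zero, zero_sub]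
      rw [neg_div, ← div_neg, neg_sub]
    · simp [h1]
    · simp only [h1, h1.not_gt, h1.ne', if_false, if_true, Nat.sub_eq_zero_of_le h1.le, add_zero,
        Nat.cast_sub h1.le, Nat.cast_zero, sub_zero]

theorem div (hf : FeasibleRat f) (hg : FeasibleRat g) : FeasibleRat fun e => f e / g e := by
  simpa only [div_eq_mul_inv] using hf.mul hg.inv

theorem comp {f : E' → ℝ} (hf : FeasibleRat f) {g : E → E'} (hg : FeasibleMap g) :
    FeasibleRat fun e => f (g e) := by
  obtain ⟨P, N, D, hP, hN, hD, h0, h⟩ := hf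
  exact ⟨_, _, _, hP.comp hg, hN.comp hg, hD.comp hg, fun e => h0 _, fun e => h _⟩

theorem le (hf : FeasibleRat f) (hg : FeasibleRat g) : FeasibleRel fun e => f e ≤ g e := by
  obtain ⟨P, N, D, hP, hN, hD, h0, h⟩ := hf
  obtain ⟨P', N', D', hP', hN', hD', h0', h'⟩ := hg
  refine (((hP.mul hD').add (hN'.mul hD)).le ((hP'.mul hD).add (hN.mul hD'))).congr fun e => ?_
  have h1 : (0 : ℝ) < D e := by exact_mod_cast h0 e
  have h2 : (0 : ℝ) < D' e := by exact_mod_cast h0' e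
  rw [h, h', div_le_div_iff₀ h1 h2, ← Nat.cast_le (α := ℝ)]
  push_cast
  constructor <;> intro h3 <;> linarith

theorem lt (hf : FeasibleRat f) (hg : FeasibleRat g) : FeasibleRel fun e => f e < g e :=
  (hg.le hf).not.congr fun _ => not_le

end FeasibleRat

/-- The nonnegative floating-point numbers in multiples of the unit. -/
def IsFloat (p q : ℕ) : Prop := ∃ m < 2 ^ p, ∃ Q < 2 ^ p * 2 ^ p + 1, (∃ i, Q = 2 ^ i) ∧ q = m * Q

theorem IsFloat.zero (p : ℕ) : IsFloat p 0 :=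
  ⟨0, by positivity, 1, by have := Nat.two_pow_pos p; nlinarith, ⟨0, rfl⟩, by simp⟩

theorem IsFloat.le {p q : ℕ} (h : IsFloat p q) : q ≤ 2 ^ p * (2 ^ p * 2 ^ p) := by
  obtain ⟨m, hm, Q, hQ, -, rfl⟩ := h
  exact Nat.mul_le_mul hm.le (Nat.le_of_lt_succ hQ)

theorem IsFloat.mem_floats {p q : ℕ} (h : IsFloat p q) : (q : ℝ) / 2 ^ p ∈ floats p := by
  obtain ⟨m, hm, Q, hQ, ⟨i, rfl⟩, rfl⟩ := h
  have hi : i ≤ p + p := by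
    rw [← pow_add] at hQ
    exact (Nat.pow_le_pow_iff_right (a := 2) (by norm_num)).1 (Nat.le_of_lt_succ hQ)
  refine ⟨m, (i : ℤ) - p, ?_, ?_, ?_⟩
  · rw [abs_of_nonneg (by positivity)]
    exact_mod_cast hm
  · rw [abs_le]
    omega
  · rw [zpow_sub₀ (by norm_num)]
    push_cast
    rw [zpow_natCast, zpow_natCast]
    ring

theorem exists_isFloat {p : ℕ} {y : ℝ} (h : y ∈ floats p) (h0 : 0 ≤ y) :
    ∃ q : ℕ, IsFloat p q ∧ y = q / 2 ^ p := by
  obtain ⟨m, e, hm, he, rfl⟩ := h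
  have h2 : (0 : ℝ) < 2 ^ e := by positivity
  have hm0 : 0 ≤ m := by
    have : (0 : ℝ) ≤ m := nonneg_of_mul_nonneg_left h0 h2
    exact_mod_cast this
  rw [abs_of_nonneg hm0] at hm
  rw [abs_le] at he
  obtain ⟨m, rfl⟩ := Int.eq_ofNat_of_zero_le hm0
  obtain ⟨i, hi⟩ := Int.eq_ofNat_of_zero_le (show 0 ≤ e + p by omega)
  refine ⟨m * 2 ^ i, ⟨m, by exact_mod_cast hm, 2 ^ i, ?_, ⟨i, rfl⟩, rfl⟩, ?_⟩
  · rw [← pow_add]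
    exact Nat.lt_succ_of_le (Nat.pow_le_pow_right (by norm_num) (by omega))
  · rw [show e = (i : ℤ) - p by omega, zpow_sub₀ (by norm_num)]
    push_cast
    rw [zpow_natCast, zpow_natCast]
    ring

open Classical in
-- For x ≥ 0 the supremum is attained by a nonnegative float, because 0 is one. In units of `2 ^
-- (-p)` all floats are at most `2 ^ (3 * p)`, so a search with a polynomial bound finds it;
-- saturation on overflow is built in.
theorem sSup_floats (p : ℕ) {x : ℝ} (hx : 0 ≤ x) :
    sSup {y | y ∈ floats p ∧ y ≤ x} =
      (Nat.findGreatest (fun q => IsFloat p q ∧ (q : ℝ) ≤ x * 2 ^ p)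
        (2 ^ p * (2 ^ p * 2 ^ p)) : ℝ) / 2 ^ p := by
  have hU : (0 : ℝ) < 2 ^ p := by positivity
  have h0 : IsFloat p 0 ∧ ((0 : ℕ) : ℝ) ≤ x * 2 ^ p := ⟨.zero p, by simp; positivity⟩
  have hs := Nat.findGreatest_spec (P := fun q => IsFloat p q ∧ (q : ℝ) ≤ x * 2 ^ p)
    (Nat.zero_le (2 ^ p * (2 ^ p * 2 ^ p))) h0
  refine IsGreatest.csSup_eq ⟨⟨hs.1.mem_floats, (div_le_iff₀ hU).2 hs.2⟩, ?_⟩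
  rintro y ⟨hy, hyx⟩
  rcases le_or_gt 0 y with hy0 | hy0
  · obtain ⟨q, hq, rfl⟩ := exists_isFloat hy hy0
    have := Nat.le_findGreatest (P := fun q => IsFloat p q ∧ (q : ℝ) ≤ x * 2 ^ p) hq.le
      ⟨hq, (div_le_iff₀ hU).1 hyx⟩
    gcongr
  · exact hy0.le.trans (by positivity)

theorem FeasibleRel.isFloat (c : ℕ) :
    FeasibleRel fun p : E × ℕ => IsFloat (bitsOf c p.1) p.2 := by
  have hU : ∀ {E : Type u} [Context α E], Feasible fun e : E => 2 ^ bitsOf c e :=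
    Feasible.two_pow_bitsOf c
  refine FeasibleRel.exists_lt hU.fst (R := fun (p : E × ℕ) m =>
    ∃ Q < 2 ^ bitsOf c p.1 * 2 ^ bitsOf c p.1 + 1, (∃ i, Q = 2 ^ i) ∧ p.2 = m * Q) ?_
  refine FeasibleRel.exists_lt (((hU.fst.fst).mul hU.fst.fst).add (.const 1))
    (R := fun (p : (E × ℕ) × ℕ) Q => (∃ i, Q = 2 ^ i) ∧ p.1.2 = p.2 * Q) ?_
  exact (FeasibleRel.isPowerOfTwo .snd).and (Feasible.snd.fst.fst.eq (Feasible.snd.fst.mul .snd))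

/-- Rounding inspects a real number only through its comparisons with multiples of the unit, so `f`
itself may be irrational. -/
theorem FeasibleReal.rnd_of_le {c : ℕ} {f : E → ℝ}
    (hpos : FeasibleRel fun p : E × ℕ => (p.2 : ℝ) ≤ f p.1 * 2 ^ bitsOf c p.1)
    (hneg : FeasibleRel fun p : E × ℕ => (p.2 : ℝ) ≤ -f p.1 * 2 ^ bitsOf c p.1) :
    FeasibleReal c fun e => rnd (bitsOf c e) (f e) := by
  classical
  have hU : Feasible fun e : E => 2 ^ bitsOf c e := .two_pow_bitsOf c
  have hB := hU.mul (hU.mul hU)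
  have hsign : FeasibleRel fun e => 0 ≤ f e := by
    refine FeasibleRel.congr (hpos.comp (FeasibleMap.id.pair (.const 0))) fun e => ?_
    simp only [Nat.cast_zero]
    exact mul_nonneg_iff_of_pos_right (by positivity)
  have h1 := Feasible.findGreatest hB
    (R := fun e q => IsFloat (bitsOf c e) q ∧ (q : ℝ) ≤ f e * 2 ^ bitsOf c e)
    ((FeasibleRel.isFloat c).and hpos)
  have h2 := Feasible.findGreatest hB
    (R := fun e q => IsFloat (bitsOf c e) q ∧ (q : ℝ) ≤ -f e * 2 ^ bitsOf c e)
    ((FeasibleRel.isFloat c).and hneg)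
  refine ⟨_, _, .ite hsign h1 (.const 0), .ite hsign (.const 0) h2, fun e => ?_⟩
  beta_reduce
  unfold rnd
  split_ifs with h
  · rw [sSup_floats _ h]
    simp
  · rw [sSup_floats _ (by linarith : 0 ≤ -f e)]
    simp [neg_div]

theorem FeasibleRat.two_pow_bitsOf (c : ℕ) : FeasibleRat fun e : E => (2 : ℝ) ^ bitsOf c e := by
  simpa using FeasibleRat.natCast (Feasible.two_pow_bitsOf (E := E) c)

theorem FeasibleRat.rnd {f : E → ℝ} (hf : FeasibleRat f) (c : ℕ) :
    FeasibleReal c fun e => rnd (bitsOf c e) (f e) := by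
  have h1 := hf.comp FeasibleMap.fst
  have h2 := (FeasibleRat.two_pow_bitsOf (E := E) c).comp FeasibleMap.fst
  exact FeasibleReal.rnd_of_le ((FeasibleRat.natCast .snd).le (h1.mul h2))
    ((FeasibleRat.natCast .snd).le (h1.neg.mul h2))

/-- The comparison q ≤ √f * 2 ^ p is decided after squaring. The case q = 0 is separate: it holds
even for negative `f`, whose root is 0. -/
theorem FeasibleRat.rnd_sqrt {f : E → ℝ} (hf : FeasibleRat f) (c : ℕ) :
    FeasibleReal c fun e => _root_.rnd (bitsOf c e) √(f e) := by
  have h1 := hf.comp FeasibleMap.fst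
  have h2 := (FeasibleRat.two_pow_bitsOf (E := E) c).comp FeasibleMap.fst
  have h3 : FeasibleRat fun p : E × ℕ => (p.2 : ℝ) := .natCast .snd
  refine FeasibleReal.rnd_of_le ?_ ?_
  · refine ((Feasible.snd.eq (.const 0)).or
      ((h3.mul h3).le (h1.mul (h2.mul h2)))).congr fun ⟨e, q⟩ => ?_
    have hU : (0 : ℝ) < 2 ^ bitsOf c e := by positivity
    have hq : (0 : ℝ) ≤ q := by positivity
    simp only
    constructor
    · rintro (rfl | h)
      · simp only [Nat.cast_zero]
        positivity
      · rw [← div_le_iff₀ hU]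
        refine Real.le_sqrt_of_sq_le ?_
        rw [div_pow, div_le_iff₀ (by positivity)]
        nlinarith
    · intro h
      rcases Nat.eq_zero_or_pos q with rfl | hq0
      · exact .inl rfl
      · right
        have hq0 : (0 : ℝ) < q := by exact_mod_cast hq0
        have hs : 0 < √(f e) := pos_of_mul_pos_left (hq0.trans_le h) hU.le
        have hf0 := Real.sqrt_pos.1 hs
        have := mul_self_le_mul_self hq h
        nlinarith [Real.mul_self_sqrt hf0.le]
  · refine ((Feasible.snd.eq (.const 0)).and
      (h1.le (by simpa using FeasibleRat.const (E := E × ℕ) 0))).congr fun ⟨e, q⟩ => ?_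
    have hU : (0 : ℝ) < 2 ^ bitsOf c e := by positivity
    have hq : (0 : ℝ) ≤ q := by positivity
    have hs := Real.sqrt_nonneg (f e)
    simp only
    constructor
    · rintro ⟨rfl, h⟩
      rw [Real.sqrt_eq_zero_of_nonpos h]
      simp
    · intro h
      have h3 : √(f e) * 2 ^ bitsOf c e = 0 := by nlinarith [mul_nonneg hs hU.le]
      have h4 : (q : ℝ) = 0 := by nlinarith
      exact ⟨by exact_mod_cast h4,
        Real.sqrt_eq_zero'.1 ((mul_eq_zero.1 h3).resolve_right hU.ne')⟩

/-! ### Sums, maxima and uniform maps at fixed precision -/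

namespace FeasibleReal

variable {c : ℕ} {f g : E → ℝ}

theorem rat (hf : FeasibleReal c f) : FeasibleRat f := by
  obtain ⟨P, N, hP, hN, h⟩ := hf
  exact ⟨P, N, _, hP, hN, .two_pow_bitsOf c, fun e => by positivity, fun e => by simp [h]⟩

theorem comp {f : E' → ℝ} (hf : FeasibleReal c f) {g : E → E'} (hg : FeasibleMap g) :
    FeasibleReal c fun e => f (g e) := by
  obtain ⟨P, N, hP, hN, h⟩ := hf
  exact ⟨_, _, hP.comp hg, hN.comp hg, fun e => by beta_reduce; rw [h, bitsOf, bitsOf, hg.str_eq]⟩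

theorem const_rnd (c : ℕ) (q : ℚ) : FeasibleReal c fun e : E => rnd (bitsOf c e) (q : ℝ) :=
  (FeasibleRat.const q).rnd c

theorem zero : FeasibleReal c fun _ : E => (0 : ℝ) :=
  ⟨_, _, .const 0, .const 0, fun _ => by simp⟩

theorem add (hf : FeasibleReal c f) (hg : FeasibleReal c g) :
    FeasibleReal c fun e => f e + g e := by
  obtain ⟨P, N, hP, hN, h⟩ := hf
  obtain ⟨P', N', hP', hN', h'⟩ := hg
  refine ⟨_, _, hP.add hP', hN.add hN', fun e => ?_⟩
  beta_reduce
  rw [h, h', ← add_div]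
  push_cast
  ring

theorem sum {ι : Type*} (s : Finset ι) {f : ι → E → ℝ} (hf : ∀ i, FeasibleReal c (f i)) :
    FeasibleReal c fun e => ∑ i ∈ s, f i e := by
  classical
  induction s using Finset.induction_on with
  | empty => simpa using zero
  | insert i s hi ih => simpa only [Finset.sum_insert hi] using (hf i).add ih

theorem ite {R : E → Prop} [DecidablePred R] (hR : FeasibleRel R) (hf : FeasibleReal c f)
    (hg : FeasibleReal c g) : FeasibleReal c fun e => if R e then f e else g e := by
  obtain ⟨P, N, hP, hN, h⟩ := hf
  obtain ⟨P', N', hP', hN', h'⟩ := hg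
  refine ⟨_, _, .ite hR hP hP', .ite hR hN hN', fun e => ?_⟩
  beta_reduce
  split_ifs
  · exact h e
  · exact h' e

theorem sum_fin {F : (e : E) × Fin ((str e).1 + 1) → ℝ} (hF : FeasibleReal c F)
    {R : ∀ e : E, Fin ((str e).1 + 1) → Prop} [∀ e, DecidablePred (R e)]
    (hR : FeasibleRel fun p : (e : E) × Fin ((str e).1 + 1) => R p.1 p.2) :
    FeasibleReal c fun e => ∑ j ∈ Finset.univ.filter (R e), F ⟨e, j⟩ := by
  obtain ⟨P, N, hP, hN, h⟩ := hF
  refine ⟨_, _, hP.sum_fin hR, hN.sum_fin hR, fun e => ?_⟩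
  beta_reduce
  push_cast
  rw [← Finset.sum_sub_distrib, Finset.sum_div]
  exact Finset.sum_congr rfl fun j _ => h ⟨e, j⟩

theorem sup' {F : (e : E) × Fin ((str e).1 + 1) → ℝ} (hF : FeasibleReal c F)
    {R : ∀ e : E, Fin ((str e).1 + 1) → Prop} [∀ e, DecidablePred (R e)]
    (hR : FeasibleRel fun p : (e : E) × Fin ((str e).1 + 1) => R p.1 p.2)
    (hne : ∀ e, (Finset.univ.filter (R e)).Nonempty) :
    FeasibleReal c fun e => (Finset.univ.filter (R e)).sup' (hne e) fun j => F ⟨e, j⟩ := by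
  classical
  -- `M e y` says that y is an admissible position at which `F` is maximal. A bounded search finds
  -- such a position, and the maximum is the value of `F` there.
  let M : E → ℕ → Prop := fun e y => R (clamp (e, y)).1 (clamp (e, y)).2 ∧
    ∀ z < (str e).1 + 1, R (clamp (e, z)).1 (clamp (e, z)).2 → F (clamp (e, z)) ≤ F (clamp (e, y))
  have hM : FeasibleRel fun p : E × ℕ => M p.1 p.2 := by
    refine (hR.comp feasibleMap_clamp).and ?_
    refine FeasibleRel.forall_lt (R := fun (p : E × ℕ) z =>
      R (clamp (p.1, z)).1 (clamp (p.1, z)).2 → F (clamp (p.1, z)) ≤ F (clamp (p.1, p.2)))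
      (Feasible.last.fst.add (.const 1)) ?_
    have hz : FeasibleMap fun p : (E × ℕ) × ℕ => clamp (p.1.1, p.2) :=
      feasibleMap_clamp.comp ((FeasibleMap.fst.comp FeasibleMap.fst).pair .snd)
    have hy : FeasibleMap fun p : (E × ℕ) × ℕ => clamp (p.1.1, p.1.2) :=
      feasibleMap_clamp.comp FeasibleMap.fst
    exact (hR.comp hz).imp ((hF.comp hz).rat.le (hF.comp hy).rat)
  have hj := Feasible.findGreatest Feasible.last hM
  have h := hF.comp (feasibleMap_clamp.comp (FeasibleMap.id.pair hj))
  convert h using 2 with e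
  obtain ⟨i, hi, hmax⟩ := Finset.exists_max_image _ (fun j => F ⟨e, j⟩) (hne e)
  rw [Finset.mem_filter] at hi
  have hMi : M e i := by
    refine ⟨by rw [clamp_val]; exact hi.2, fun z hz hRz => ?_⟩
    rw [clamp_val]
    exact hmax _ (Finset.mem_filter.2 ⟨Finset.mem_univ _, hRz⟩)
  have hs : M e (Nat.findGreatest (M e) (str e).1) :=
    Nat.findGreatest_spec (Nat.le_of_lt_succ i.2) hMi
  refine le_antisymm (Finset.sup'_le _ _ fun j hj => ?_) ?_
  · have := hs.2 j j.2
    rw [clamp_val] at this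
    exact this (Finset.mem_filter.1 hj).2
  · have hR' : R e (clamp (e, Nat.findGreatest (M e) (str e).1)).2 := hs.1
    exact Finset.le_sup' (fun j => F ⟨e, j⟩) (Finset.mem_filter.2 ⟨Finset.mem_univ _, hR'⟩)

theorem scalar (ω : UniformMap 3) (hf : FeasibleReal c f) :
    FeasibleReal c fun e => ω.scalar (bitsOf c e) (f e) := by
  obtain ⟨P, N, hP, hN, h⟩ := hf
  have ht : ∀ i, Feasible ((![fun e : E => 2 ^ bitsOf c e, fun e => P e - N e,
      fun e => N e - P e] : Fin 3 → E → ℕ) i) := by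
    intro i
    fin_cases i
    exacts [.two_pow_bitsOf c, hP.sub hN, hN.sub hP]
  have h1 := (((FeasibleRat.natCast (ω.pos_le.feasible ht)).sub
    (.natCast (ω.neg_le.feasible ht))).div (.two_pow_bitsOf c)).rnd c
  convert h1 using 2 with e
  unfold UniformMap.scalar UniformMap.eval
  -- The argument is already an integer multiple of the unit, so the floor loses nothing and its two
  -- parts are truncated differences.
  have h2 : ⌊f e * 2 ^ bitsOf c e⌋ = (P e : ℤ) - N e := by
    rw [h, div_mul_cancel₀ _ (by positivity)]
    exact_mod_cast Int.floor_intCast ((P e : ℤ) - N e)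
  have h3 : (![2 ^ bitsOf c e, ⌊f e * 2 ^ bitsOf c e⌋.toNat, (-⌊f e * 2 ^ bitsOf c e⌋).toNat] :
      Fin 3 → ℕ) = fun i => (![fun e : E => 2 ^ bitsOf c e, fun e => P e - N e,
      fun e => N e - P e] : Fin 3 → E → ℕ) i e := by
    funext i
    rw [h2]
    fin_cases i <;> simp
  rw [h3]
  push_cast
  rfl

theorem position (f : UniformMap 3) {i : E → ℕ} (hi : Feasible i) :
    FeasibleReal c fun e => f.position (bitsOf c e) ((str e).1 + 1) (i e) := by
  have ht : ∀ k, Feasible ((![fun e : E => 2 ^ bitsOf c e, fun e => (str e).1 + 1, i] :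
      Fin 3 → E → ℕ) k) := by
    intro k
    fin_cases k
    exacts [.two_pow_bitsOf c, Feasible.last.add (.const 1), hi]
  have h1 := (((FeasibleRat.natCast (f.pos_le.feasible ht)).sub
    (.natCast (f.neg_le.feasible ht))).div (.two_pow_bitsOf c)).rnd c
  convert h1 using 2 with e
  unfold UniformMap.position UniformMap.eval
  have h3 : (![2 ^ bitsOf c e, (str e).1 + 1, i e] : Fin 3 → ℕ) =
      fun k => (![fun e : E => 2 ^ bitsOf c e, fun e => (str e).1 + 1, i] :
        Fin 3 → E → ℕ) k e := by
    funext k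
    fin_cases k <;> simp
  rw [h3]
  push_cast
  rfl

end FeasibleReal

end FOM

namespace FOM

open Context

variable {α : Type u} {E : Type u} [Context α E] {c : ℕ}

/-! ## The operations of a transformer are feasible -/

section

variable {ι κ : Type} [Fintype ι]

theorem FeasibleReal.fdot_univ {x y : E → ι → ℝ} (hx : ∀ j, FeasibleReal c fun e => x e j)
    (hy : ∀ j, FeasibleReal c fun e => y e j) :
    FeasibleReal c fun e => fdot (bitsOf c e) Finset.univ (x e) (y e) :=
  (FeasibleReal.sum Finset.univ fun j => ((hx j).rat.mul (hy j).rat).rnd c).rat.rnd c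

theorem FeasibleReal.affine (A : AffineMapQ ι κ) {x : E → ι → ℝ}
    (hx : ∀ j, FeasibleReal c fun e => x e j) (k : κ) :
    FeasibleReal c fun e => A.apply (bitsOf c e) (x e) k :=
  ((fdot_univ (fun j => const_rnd c (A.weight k j)) hx).rat.add
    (const_rnd c (A.bias k)).rat).rnd c

end

theorem FeasibleReal.layerNorm {d : ℕ} (N : LayerNorm d) {x : E → Fin d → ℝ}
    (hx : ∀ j, FeasibleReal c fun e => x e j) (k : Fin d) :
    FeasibleReal c fun e => N.apply (bitsOf c e) (x e) k := by
  have hd : FeasibleRat fun _ : E => (d : ℝ) := by simpa using FeasibleRat.const (E := E) d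
  have hmean := (((FeasibleReal.sum Finset.univ hx).rat.rnd c).rat.div hd).rnd c
  have hy := fun k => ((hx k).rat.sub hmean.rat).rnd c
  have hvar := ((fdot_univ hy hy).rat.div hd).rnd c
  have hsd := ((hvar.rat.add (const_rnd c N.eps).rat).rnd c).rat.rnd_sqrt c
  exact ((((const_rnd c (N.gain k)).rat.mul (((hy k).rat.div hsd.rat).rnd c).rat).rnd c).rat.add
    (const_rnd c (N.shift k)).rat).rnd c

theorem FeasibleReal.applyNorm {d : ℕ} (N : Option (LayerNorm d)) {x : E → Fin d → ℝ}
    (hx : ∀ j, FeasibleReal c fun e => x e j) (k : Fin d) :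
    FeasibleReal c fun e => applyNorm N (bitsOf c e) (x e) k := by
  cases N with
  | none => exact hx k
  | some N => exact layerNorm N hx k

/-- A string with a position. -/
abbrev Pos (α : Type u) : Type u := (w : Str α) × Fin ((str w).1 + 1)

/-- A string with two positions. -/
abbrev Pos₂ (α : Type u) : Type u := (e : Pos α) × Fin ((str e).1 + 1)

theorem feasibleMap_swap : FeasibleMap fun e : Pos₂ α => (⟨e.1.1, e.2⟩ : Pos α) :=
  FeasibleMap.sigma (FeasibleMap.sigma_fst.comp FeasibleMap.sigma_fst) Feasible.sigma_snd

section

variable {d m : ℕ} {X : (w : Str α) → Fin (w.1 + 1) → Fin d → ℝ}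

theorem FeasibleReal.score (H : Head d m) (hX : ∀ k, FeasibleReal c fun e : Pos α => X e.1 e.2 k) :
    FeasibleReal c fun e : Pos₂ α => H.score (bitsOf c e) (X e.1.1) e.1.2 e.2 := by
  have hi := fun k => (hX k).comp (FeasibleMap.sigma_fst (E := Pos α))
  have hj := fun k => (hX k).comp (feasibleMap_swap (α := α))
  have hm : FeasibleRat fun _ : Pos₂ α => (m : ℝ) := by
    simpa using FeasibleRat.const (E := Pos₂ α) m
  exact ((fdot_univ (affine H.query hi) (affine H.key hj)).rat.div (hm.rnd_sqrt c).rat).rnd c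

theorem feasibleRel_visible (H : Head d m) :
    FeasibleRel fun e : Pos₂ α => H.causal = true → e.2 ≤ e.1.2 :=
  (FeasibleRel.const (H.causal = true)).imp
    (Feasible.sigma_snd.le (Feasible.sigma_snd.comp FeasibleMap.sigma_fst))

theorem FeasibleReal.rawWeight (H : Head d m) (ω : UniformMap 3)
    (hX : ∀ k, FeasibleReal c fun e : Pos α => X e.1 e.2 k) :
    FeasibleReal c fun e : Pos₂ α => H.rawWeight ω (bitsOf c e) (X e.1.1) e.1.2 e.2 := by
  have hs := score H hX
  have hmax := FeasibleReal.sup' (E := Pos α) hs (R := fun e j => H.causal = true → j ≤ e.2)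
    (feasibleRel_visible H) fun e => H.visible_nonempty e.2
  exact ((hs.rat.sub (hmax.comp FeasibleMap.sigma_fst).rat).rnd c).scalar ω

/-- The two sums over the attended positions are exact before a single rounding, so they are
instances of iterated integer addition. -/
theorem FeasibleReal.output (H : Head d m) (ω : UniformMap 3)
    (hX : ∀ k, FeasibleReal c fun e : Pos α => X e.1 e.2 k) (k : Fin m) :
    FeasibleReal c fun e : Pos α => H.output ω (bitsOf c e) (X e.1) e.2 k := by
  have hw := rawWeight H ω hX
  have hZ := (FeasibleReal.sum_fin (E := Pos α) hw (R := fun e j => H.causal = true → j ≤ e.2)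
    (feasibleRel_visible H)).rat.rnd c
  have hv := (affine H.value (x := fun e : Pos α => X e.1 e.2) hX k).comp
    (feasibleMap_swap (α := α))
  have h := (((hw.rat.div (hZ.comp FeasibleMap.sigma_fst).rat).rnd c).rat.mul hv.rat).rnd c
  exact (FeasibleReal.sum_fin (E := Pos α) h (R := fun e j => H.causal = true → j ≤ e.2)
    (feasibleRel_visible H)).rat.rnd c

theorem FeasibleReal.block (B : Block d) (ω σ : UniformMap 3)
    (hX : ∀ k, FeasibleReal c fun e : Pos α => X e.1 e.2 k) (k : Fin d) :
    FeasibleReal c fun e : Pos α => B.apply ω σ (bitsOf c e) (X e.1) e.2 k := by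
  have hy : ∀ k, FeasibleReal c fun e : Pos α =>
      _root_.applyNorm B.preAttention (bitsOf c e.1) (X e.1 e.2) k :=
    applyNorm B.preAttention hX
  have hcomb := affine B.combine
    (x := fun (e : Pos α) hk => (B.heads hk.1).output ω (bitsOf c e)
      (fun i => _root_.applyNorm B.preAttention (bitsOf c e.1) (X e.1 i)) e.2 hk.2)
    (fun hk => output (X := fun w i => _root_.applyNorm B.preAttention (bitsOf c w) (X w i))
      (B.heads hk.1) ω hy hk.2)
  have hz := applyNorm B.postAttention fun k => ((hX k).rat.add (hcomb k).rat).rnd c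
  have hinner := affine B.inner (applyNorm B.preFeedForward hz)
  have houter := affine B.outer fun l => (hinner l).scalar σ
  exact applyNorm B.postFeedForward (fun k => ((hz k).rat.add (houter k).rat).rnd c) k

end

end FOM

/-! ### Definability of the label -/

namespace Transformer

open FOM Context

variable {α : Type u} (T : Transformer α)

/-- The hidden activations that the transformer computes on a string. -/
noncomputable def hiddenActivation (w : Str α) : T.Hidden w.1 :=
  Fin.induction (T.embed w.2) fun l h =>
    (T.blocks l).apply T.attentionWeight T.activation (T.bits (w.1 + 1)) h

/-- The label that the transformer computes on a string. -/
noncomputable def label (w : Str α) : Bool := T.classify (T.hiddenActivation w (Fin.last T.depth))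

theorem feasibleReal_embed [Finite α] (k : Fin T.dim) :
    FeasibleReal T.precision fun e : Pos α => T.embed e.1.2 e.2 k := by
  classical
  have := Fintype.ofFinite α
  have htok : FeasibleReal T.precision fun e : Pos α =>
      rnd (bitsOf T.precision e) (T.tokenEmbedding (e.1.2 e.2) k) := by
    -- The token vector is chosen by a finite sum over the alphabet, in which only the token at this
    -- position contributes.
    have h := FeasibleReal.sum (c := T.precision) (Finset.univ : Finset α) fun a =>
      FeasibleReal.ite (FeasibleRel.token (E := Pos α) Feasible.sigma_snd a)
        (.const_rnd T.precision (T.tokenEmbedding a k)) .zero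
    convert h using 2 with e
    rw [Finset.sum_eq_single (e.1.2 e.2), if_pos ⟨e.2, rfl, rfl⟩]
    · rintro a - ha
      rw [if_neg]
      rintro ⟨p, hp, rfl⟩
      exact ha (by rw [Fin.ext hp]; rfl)
    · simp
  exact (htok.rat.add (FeasibleReal.position (T.positionEmbedding k)
    (Feasible.sigma_snd.add (.const 1))).rat).rnd _

theorem feasibleReal_activation [Finite α] (l : Fin (T.depth + 1)) :
    ∀ k, FeasibleReal T.precision fun e : Pos α => T.hiddenActivation e.1 l e.2 k := by
  induction l using Fin.induction with
  | zero => exact T.feasibleReal_embed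
  | succ l ih =>
    exact FeasibleReal.block (X := fun w i => T.hiddenActivation w l.castSucc i)
      (T.blocks l) T.attentionWeight T.activation ih

theorem feasibleRel_label [Finite α] : FeasibleRel fun w : Str α => T.label w = true := by
  have hlast : FeasibleMap fun w : Str α => (⟨w, Fin.last w.1⟩ : Pos α) :=
    FeasibleMap.id.sigma Feasible.last
  have h := FeasibleReal.affine T.classifier (FeasibleReal.applyNorm T.finalNorm fun k =>
    (T.feasibleReal_activation (Fin.last T.depth) k).comp hlast) ()
  refine ((FeasibleReal.zero (c := T.precision)).rat.lt h.rat).congr fun w => ?_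
  simp only [label, classify, decide_eq_true_eq]
  rfl

end Transformer

namespace FOM

variable {α : Type u}

/-! ## Sentences -/

/-- A property of strings that is defined by a sentence. -/
def Axiomatizable (P : Str α → Prop) : Prop :=
  ∃ φ : Sentence α, ∀ w, φ.Sat w Fin.elim0 ↔ P w

namespace Axiomatizable

variable {P Q : Str α → Prop}

theorem congr (hP : Axiomatizable P) (h : ∀ w, P w ↔ Q w) : Axiomatizable Q :=
  let ⟨φ, hφ⟩ := hP
  ⟨φ, fun w => (hφ w).trans (h w)⟩

theorem not (hP : Axiomatizable P) : Axiomatizable fun w => ¬ P w :=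
  let ⟨φ, hφ⟩ := hP
  ⟨.not φ, fun w => not_congr (hφ w)⟩

theorem and (hP : Axiomatizable P) (hQ : Axiomatizable Q) : Axiomatizable fun w => P w ∧ Q w :=
  let ⟨φ, hφ⟩ := hP
  let ⟨ψ, hψ⟩ := hQ
  ⟨.and φ ψ, fun w => and_congr (hφ w) (hψ w)⟩

theorem or (hP : Axiomatizable P) (hQ : Axiomatizable Q) : Axiomatizable fun w => P w ∨ Q w :=
  let ⟨φ, hφ⟩ := hP
  let ⟨ψ, hψ⟩ := hQ
  ⟨.or φ ψ, fun w => or_congr (hφ w) (hψ w)⟩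

theorem true : Axiomatizable fun _ : Str α => True :=
  ⟨.eq .one .one, fun w => by simp [Formula.Sat]⟩

theorem forall_mem {ι : Type*} {s : Set ι} (hs : s.Finite) {P : ι → Str α → Prop}
    (hP : ∀ i, Axiomatizable (P i)) : Axiomatizable fun w => ∀ i ∈ s, P i w := by
  induction s, hs using Set.Finite.induction_on with
  | empty => exact true.congr fun w => by simp
  | @insert i s _ _ ih => exact ((hP i).and ih).congr fun w => by simp

end Axiomatizable

theorem Term.exists_eval_eq (c : ℕ) : ∃ t : Term 0, ∀ n v, t.eval n v = c := by
  induction c with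
  | zero => exact ⟨.sub .one .one, fun n v => by simp [Term.eval]⟩
  | succ c ih =>
    obtain ⟨t, ht⟩ := ih
    exact ⟨.add t .one, fun n v => by simp [Term.eval, ht]⟩

/-- A string is determined by its length and its finitely many tokens, and fixed positions are named
by sums of ones. -/
theorem Axiomatizable.singleton (w₀ : Str α) : Axiomatizable fun w => w = w₀ := by
  have hlen : Axiomatizable fun w : Str α => w.1 = w₀.1 := by
    obtain ⟨t, ht⟩ := Term.exists_eval_eq (w₀.1 + 1)
    refine ⟨.eq .len t, fun w => ?_⟩
    simp only [Formula.Sat, Term.eval, ht]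
    omega
  have htok : ∀ p : Fin (w₀.1 + 1), Axiomatizable fun w : Str α =>
      ∃ q : Fin (w.1 + 1), (q : ℕ) = p ∧ w.2 q = w₀.2 p := by
    intro p
    obtain ⟨t, ht⟩ := Term.exists_eval_eq (p + 1)
    refine ⟨.token (w₀.2 p) t, fun w => ?_⟩
    simp only [Formula.Sat, ht]
    exact exists_congr fun q => and_congr_left' (by omega)
  refine (hlen.and (Axiomatizable.forall_mem Set.finite_univ htok)).congr fun w => ?_
  constructor
  · rintro ⟨h, h'⟩
    obtain ⟨n, a⟩ := w
    obtain ⟨n', a'⟩ := w₀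
    obtain rfl : n = n' := h
    congr 1
    funext p
    obtain ⟨q, hq, hq'⟩ := h' p (Set.mem_univ _)
    exact (congrArg a (Fin.ext hq)).symm.trans hq'
  · rintro rfl
    exact ⟨rfl, fun p _ => ⟨p, rfl, rfl⟩⟩

theorem Axiomatizable.of_finite {S : Set (Str α)} (hS : S.Finite) :
    Axiomatizable fun w => w ∈ S := by
  refine (Axiomatizable.forall_mem hS fun w₀ => (Axiomatizable.singleton w₀).not).not.congr
    fun w => ?_
  simp

theorem finite_setOf_lt [Finite α] (N : ℕ) : {w : Str α | w.1 < N}.Finite := by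
  refine (Set.finite_range fun x : (n : Fin N) × (Fin ((n : ℕ) + 1) → α) =>
    (⟨x.1, x.2⟩ : Str α)).subset ?_
  rintro ⟨n, a⟩ h
  exact ⟨⟨⟨n, h⟩, a⟩, rfl⟩

/-- Definability speaks only of strings of length at least 8. Over a finite alphabet there are
finitely many shorter ones, and those with the property are listed. -/
theorem FeasibleRel.axiomatizable [Finite α] {P : Str α → Prop} (hP : FeasibleRel P) :
    Axiomatizable P := by
  obtain ⟨φ, hφ⟩ := hP.subst (k := 0) (γ := fun w _ => w) fun _ _ => rfl
  have hlt := finite_setOf_lt (α := α) 7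
  have h1 : Axiomatizable fun w : Str α => φ.Sat w Fin.elim0 := ⟨φ, fun _ => Iff.rfl⟩
  refine (((Axiomatizable.of_finite hlt).not.and h1).or (Axiomatizable.of_finite
    (hlt.subset (Set.inter_subset_left (t := {w | P w}))))).congr fun w => ?_
  have h2 : 7 ≤ w.1 → (φ.Sat w Fin.elim0 ↔ P w) := fun hw => by
    have h3 := hφ w Fin.elim0 ⟨hw, fun i => i.elim0⟩
    rwa [Subsingleton.elim (fun i : Fin 0 => _) Fin.elim0] at h3
  simp only [Set.mem_inter_iff, Set.mem_ofPred_eq, not_lt]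
  rcases le_or_gt 7 w.1 with hw | hw
  · simp [hw, hw.not_gt, h2 hw]
  · simp [hw, hw.not_ge]

end FOM

namespace Transformer

variable {α : Type u} (T : Transformer α)

/-! ## The dynamics of a transformer -/

/-- The state in which all neurons have the values that the transformer computes. -/
noncomputable def fixedState (w : Str α) : T.network.State := ⟨w.1, w.2, T.label w, T.hiddenActivation w⟩

theorem hiddenActivation_zero (w : Str α) : T.hiddenActivation w 0 = T.embed w.2 :=
  Fin.induction_zero _ _

theorem hiddenActivation_succ (w : Str α) (l : Fin T.depth) :
    T.hiddenActivation w l.succ = (T.blocks l).apply T.attentionWeight T.activation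
      (T.bits (w.1 + 1)) (T.hiddenActivation w l.castSucc) :=
  Fin.induction_succ _ _ l

theorem step_mk (n : ℕ) (w : Fin (n + 1) → α) (b : Bool) (h : T.Hidden n) :
    T.step ⟨n, w, b, h⟩ = ⟨n, w, T.classify (h (Fin.last T.depth)),
      Fin.cases (T.embed w) fun l =>
        (T.blocks l).apply T.attentionWeight T.activation (T.bits (n + 1)) (h l.castSucc)⟩ :=
  rfl

/-- Correct values move up one layer per update, whatever the initial state. Layer `l` is correct
from time `l + 1` on, and the label, which reads the last layer, from time `T.depth + 2` on. -/
theorem iterate_step (n : ℕ) (w : Fin (n + 1) → α) (b : Bool) (h : T.Hidden n) (t : ℕ) :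
    ∃ b' h', T.step^[t] ⟨n, w, b, h⟩ = ⟨n, w, b', h'⟩ ∧
      (∀ l : Fin (T.depth + 1), (l : ℕ) < t → h' l = T.hiddenActivation ⟨n, w⟩ l) ∧
      (T.depth + 1 < t → b' = T.label ⟨n, w⟩) := by
  induction t with
  | zero => exact ⟨b, h, rfl, fun l hl => absurd hl (Nat.not_lt_zero _), fun h => by omega⟩
  | succ t ih =>
    obtain ⟨b', h', e, hl, -⟩ := ih
    rw [Function.iterate_succ_apply', e, step_mk]
    refine ⟨_, _, rfl, fun l => ?_, fun ht => ?_⟩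
    · refine Fin.cases (fun _ => ?_) (fun l hlt => ?_) l
      · rw [Fin.cases_zero, hiddenActivation_zero]
      · rw [Fin.cases_succ, hiddenActivation_succ, hl l.castSucc (by simpa using hlt)]
    · rw [hl (Fin.last T.depth) (by rw [Fin.val_last]; omega), label]

theorem iterate_step_eq (x : T.State) {t : ℕ} (ht : T.depth + 1 < t) :
    T.step^[t] x = T.fixedState ⟨x.1, x.2.1⟩ := by
  obtain ⟨n, w, b, h⟩ := x
  obtain ⟨b', h', e, hl, hb⟩ := T.iterate_step n w b h t
  rw [e, hb ht, show h' = T.hiddenActivation ⟨n, w⟩ from funext fun l => hl l (by omega)]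
  rfl

theorem iterate_update_eq (x : T.network.State) {t : ℕ} (ht : T.depth + 1 < t) :
    T.network.update^[t] x = T.fixedState (T.network.vis x).1 :=
  T.iterate_step_eq x ht

/-- Every trajectory is eventually constant, so a limit along a subsequence is that constant.
Conversely, each fixed state is the limit of its own trajectory. -/
theorem Xinf_network : T.network.Xinf = Set.range T.fixedState := by
  ext x
  constructor
  · rintro ⟨x₀, t, ht, hx⟩
    refine ⟨(T.network.vis x₀).1, tendsto_nhds_unique (tendsto_const_nhds.congr' ?_) hx⟩
    filter_upwards [eventually_gt_atTop (T.depth + 1)] with k hk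
    exact (T.iterate_update_eq x₀ (hk.trans_le (ht.le_apply))).symm
  · rintro ⟨w, rfl⟩
    refine ⟨T.fixedState w, id, strictMono_id, tendsto_const_nhds.congr' ?_⟩
    filter_upwards [eventually_gt_atTop (T.depth + 1)] with k hk
    exact (T.iterate_update_eq (T.fixedState w) hk).symm

theorem isStable_network : T.network.IsStable := by
  intro x
  refine tendsto_const_nhds.congr' ?_
  filter_upwards [eventually_gt_atTop (T.depth + 1)] with t ht
  refine (Metric.infDist_zero_of_mem ?_).symm
  rw [T.iterate_update_eq x ht, Xinf_network]
  exact ⟨_, rfl⟩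

theorem represented_encoding :
    CandidateNetwork.represented T.encoding Set.sUnion = {M | M.2 = T.label M.1} := by
  unfold CandidateNetwork.represented
  rw [Xinf_network]
  refine Set.ext fun ⟨w, b⟩ => ⟨?_, ?_⟩
  · rintro ⟨_, ⟨_, ⟨w', rfl⟩, rfl⟩, h⟩
    obtain ⟨rfl, rfl⟩ := Prod.mk.inj (Set.mem_singleton_iff.1 h)
    rfl
  · intro h
    obtain rfl : b = T.label w := h
    exact ⟨_, ⟨_, ⟨w, rfl⟩, rfl⟩, rfl⟩

end Transformer

/-! ### From definability to semantic encoding -/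

theorem CandidateNetwork.isSemanticEncoding_of_models_eq {N : CandidateNetwork.{u}}
    {S : LogicalSystem.{u}} {i : N.EncodingFunction S} {Agg : Set (Set S.Interp) → Set S.Interp}
    {L : Set S.Sentence} (hne : (represented i Agg).Nonempty) (h : represented i Agg = S.models L) :
    IsSemanticEncoding i Agg L :=
  ⟨⟨hne, h.subset⟩, fun _ => h ▸ Iff.rfl⟩

theorem mainTheorem10 {α : Type u} [Finite α] [Nonempty α] (T : Transformer α) :
    T.network.IsStable ∧
      ∃ φ : FOM.Sentence α,
        CandidateNetwork.IsSemanticEncoding T.encoding Set.sUnion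
          {(⟨φ⟩ : LogicalSystem.AlphaIff (FOM.Sentence α))} := by
  obtain ⟨φ, hφ⟩ := T.feasibleRel_label.axiomatizable
  refine ⟨T.isStable_network, φ, CandidateNetwork.isSemanticEncoding_of_models_eq ?_ ?_⟩
  · rw [T.represented_encoding]
    obtain ⟨a⟩ := ‹Nonempty α›
    exact ⟨(⟨0, fun _ => a⟩, T.label ⟨0, fun _ => a⟩), rfl⟩
  · rw [T.represented_encoding]
    ext ⟨w, b⟩
    -- An equivalence with the defining sentence is the same as equality with the label; the rest
    -- only unfolds truth of singleton knowledge-bases.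
    have h : (b = true ↔ φ.Sat w Fin.elim0) ↔ b = T.label w := by
      rw [hφ w]
      exact Bool.eq_iff_iff.symm
    refine h.symm.trans ⟨?_, fun h' => ?_⟩
    · rintro h' _ rfl
      exact h'.trans ⟨by rintro h'' _ rfl; exact h'', fun h'' => h'' φ rfl⟩
    · exact (h' _ rfl).trans ⟨fun h'' => h'' φ rfl, by rintro h'' _ rfl; exact h''⟩
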